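/- Let $F:\mathbb R^N\to\mathbb R^N$ be globally Lipschitz continuous and let $\Phi(x,\cdot)$ denote the unique global solution of $\frac{d}{ds}X(s)=F(X(s))$, $X(0)=x$. Let $\mu$ be a positive Borel measure on $\mathbb R^N$, finite on compact sets and invariant under the flow, i.e. $\mu(\{\Phi(x,t):x\in A\})=\mu(A)$ for every Borel set $A$ and every $t\in\mathbb R$. "Measurable" (for test functions below) means either Borel measurable, or measurable with respect to the $\mu$-completion of the Borel $\sigma$-algebra; the theorem holds under each convention. Let $\Omega\subset\mathbb R^N$ be open and, for $x\in\Omega$, put $\tau_\pm(x)=\inf\{s>0:\Phi(x,\pm s)\notin\Omega\}\in[0,\infty]$ (with $\inf\varnothing=\infty$). Let $\mathfrak Y$ be the set of all measurable bounded functions $\psi:\Omega\to\mathbb R$ with compact support in $\Omega$ such that, for every $x\in\Omega$, the map $s\mapsto\psi(\Phi(x,s))$ is continuously differentiable on $(-\tau_-(x),\tau_+(x))$, and such that $x\mapsto D\psi(x):=\frac{d}{ds}\psi(\Phi(x,s))\big|_{s=0}$ is measurable and bounded on $\Omega$. Here the support of $\psi$ is $\Omega\setminus\omega$, where $\omega$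 is the largest open subset of $\Omega$ on which $\psi$ vanishes $\mu$-almost everywhere. The domain $\mathscr D(\mathcal T_{\max})$ of the maximal transport operator consists of all $f\in L^1(\Omega,d\mu)$ for which there is $g\in L^1(\Omega,d\mu)$ with $$\int_\Omega g\,\psi\,d\mu=\int_\Omega f\,D\psi\,d\mu\qquad\text{for all }\psi\in\mathfrak Y;$$ such a $g$ is unique in $L^1(\Omega,d\mu)$ and one sets $\mathcal T_{\max}f:=g$. Theorem. Let $f\in L^1(\Omega,d\mu)$. The following are equivalent: (1) There exist $g\in L^1(\Omega,d\mu)$ and a representative $f^\sharp$ of $f$ (that is, $f^\sharp=f$ $\mu$-almost everywhere on $\Omega$) such that, for $\mu$-almost every $x\in\Omega$ and all $-\tau_-(x)<t_1\le t_2<\tau_+(x)$, the function $s\mapsto g(\Phi(x,s))$ is integrable on $[t_1,t_2]$ and $$f^\sharp(\Phi(x,t_1))-f^\sharp(\Phi(x,t_2))=\int_{t_1}^{t_2}g(\Phi(x,s))\,ds .$$ (2) $f\in\mathscr D(\mathcal T_{\max})$. In this case $g=\mathcal T_{\max}f$: if $f\in\mathscr D(\mathcal T_{\max})$, then a function $g\in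 L^1(\Omega,d\mu)$ has the property in (1) for some representative $f^\sharp$ of $f$ if and only if $g=\mathcal T_{\max}f$ $\mu$-almost everywhere on $\Omega$. -/

import Mathlib

open MeasureTheory Set Filter Topology
open scoped NNReal

namespace Transport

/-! ### The flow of a globally Lipschitz vector field -/

/-- Two integral curves that agree at a time of an interval agree on the interval. -/
theorem curve_unique {N : ℕ} {F : EuclideanSpace ℝ (Fin N) → EuclideanSpace ℝ (Fin N)} {κ : ℝ≥0}
    (hF : LipschitzWith κ F) {X Y : ℝ → EuclideanSpace ℝ (Fin N)} {a b t₀ : ℝ}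
    (ht₀ : t₀ ∈ Ioo a b) (hX : ∀ t ∈ Ioo a b, HasDerivAt X (F (X t)) t)
    (hY : ∀ t ∈ Ioo a b, HasDerivAt Y (F (Y t)) t) (h : X t₀ = Y t₀) : EqOn X Y (Ioo a b) :=
  ODE_solution_unique_of_mem_Ioo (v := fun _ => F) (s := fun _ => univ) (K := κ)
    (fun _ _ => hF.lipschitzOnWith) ht₀ (fun t ht => ⟨hX t ht, mem_univ _⟩)
    (fun t ht => ⟨hY t ht, mem_univ _⟩) h

/-- Gluing two integral curves along an overlap of their intervals of definition. -/
theorem curve_glue {N : ℕ} {F : EuclideanSpace ℝ (Fin N) → EuclideanSpace ℝ (Fin N)} {κ : ℝ≥0}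
    (hF : LipschitzWith κ F) {X Y : ℝ → EuclideanSpace ℝ (Fin N)} {a b c d t₀ : ℝ}
    (hac : a ≤ c) (hbd : b ≤ d) (ht₀ : t₀ ∈ Ioo c b)
    (hX : ∀ t ∈ Ioo a b, HasDerivAt X (F (X t)) t)
    (hY : ∀ t ∈ Ioo c d, HasDerivAt Y (F (Y t)) t) (h : X t₀ = Y t₀) :
    ∃ Z : ℝ → EuclideanSpace ℝ (Fin N), (∀ t ∈ Ioo a b, Z t = X t) ∧
      (∀ t ∈ Ioo c d, Z t = Y t) ∧ ∀ t ∈ Ioo a d, HasDerivAt Z (F (Z t)) t := by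
  have heq : EqOn X Y (Ioo c b) :=
    curve_unique hF ht₀ (fun t ht => hX t ⟨hac.trans_lt ht.1, ht.2⟩)
      (fun t ht => hY t ⟨ht.1, ht.2.trans_le hbd⟩) h
  have hZX : ∀ t ∈ Ioo a b, (fun t => if t < t₀ then X t else Y t) t = X t := by
    intro t ht
    by_cases h1 : t < t₀
    · simp [h1]
    · simp only [h1, if_false]
      exact (heq ⟨ht₀.1.trans_le (not_lt.1 h1), ht.2⟩).symm
  have hZY : ∀ t ∈ Ioo c d, (fun t => if t < t₀ then X t else Y t) t = Y t := by
    intro t ht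
    by_cases h1 : t < t₀
    · simp only [h1, if_true]
      exact heq ⟨ht.1, h1.trans ht₀.2⟩
    · simp [h1]
  refine ⟨fun t => if t < t₀ then X t else Y t, hZX, hZY, fun t ht => ?_⟩
  by_cases h1 : t < b
  · have hm : t ∈ Ioo a b := ⟨ht.1, h1⟩
    rw [hZX t hm]
    exact (hX t hm).congr_of_eventuallyEq
      (Filter.mem_of_superset (isOpen_Ioo.mem_nhds hm) hZX)
  · have hm : t ∈ Ioo c d := ⟨(ht₀.1.trans ht₀.2).trans_le (not_lt.1 h1), ht.2⟩
    rw [hZY t hm]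
    exact (hY t hm).congr_of_eventuallyEq
      (Filter.mem_of_superset (isOpen_Ioo.mem_nhds hm) hZY)

/-- Local integral curves exist on a time interval whose length does not depend on the point. -/
theorem exists_local_curve {N : ℕ} {F : EuclideanSpace ℝ (Fin N) → EuclideanSpace ℝ (Fin N)}
    {κ : ℝ≥0} (hF : LipschitzWith κ F) (x : EuclideanSpace ℝ (Fin N)) (t₀ : ℝ) :
    ∃ X : ℝ → EuclideanSpace ℝ (Fin N), X t₀ = x ∧
      ∀ t ∈ Ioo (t₀ - 1 / (1 + κ)) (t₀ + 1 / (1 + κ)), HasDerivAt X (F (X t)) t := by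
  have hpos : (0 : ℝ) < 1 / (1 + κ) := by positivity
  have hmem : t₀ ∈ Icc (t₀ - 1 / (1 + (κ : ℝ))) (t₀ + 1 / (1 + κ)) :=
    ⟨by linarith, by linarith⟩
  have hPL : IsPicardLindelof (fun _ : ℝ => F)
      (⟨t₀, hmem⟩ : Icc (t₀ - 1 / (1 + (κ : ℝ))) (t₀ + 1 / (1 + κ))) x
      (‖F x‖₊) 0 ((1 + κ) * ‖F x‖₊) κ :=
    { lipschitzOnWith := fun _ _ => hF.lipschitzOnWith
      continuousOn := fun _ _ => continuousOn_const
      norm_le := by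
        intro _ _ y hy
        have h1 : ‖F y - F x‖ ≤ κ * ‖F x‖ := by
          rw [← dist_eq_norm]
          refine (hF.dist_le_mul y x).trans ?_
          have := Metric.mem_closedBall.1 hy
          simp only [coe_nnnorm] at this
          gcongr
        have h2 : ‖F y‖ ≤ ‖F y - F x‖ + ‖F x‖ := by
          simpa using norm_add_le (F y - F x) (F x)
        push_cast
        linarith
      mul_max_le := by
        have h1 : max (t₀ + 1 / (1 + (κ : ℝ)) - t₀) (t₀ - (t₀ - 1 / (1 + κ))) = 1 / (1 + κ) := by
          simp
        simp only [h1]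
        push_cast
        have : (1 + (κ : ℝ)) ≠ 0 := by positivity
        field_simp
        simp }
  obtain ⟨X, h0, hX⟩ := hPL.exists_eq_forall_mem_Icc_hasDerivWithinAt₀
  exact ⟨X, h0, fun t ht => (hX t (Ioo_subset_Icc_self ht)).hasDerivAt (Icc_mem_nhds ht.1 ht.2)⟩

/-- A globally Lipschitz vector field has a global integral curve through every point. -/
theorem exists_global_curve {N : ℕ} {F : EuclideanSpace ℝ (Fin N) → EuclideanSpace ℝ (Fin N)}
    {κ : ℝ≥0} (hF : LipschitzWith κ F) (x : EuclideanSpace ℝ (Fin N)) :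
    ∃ X : ℝ → EuclideanSpace ℝ (Fin N), X 0 = x ∧ ∀ t, HasDerivAt X (F (X t)) t := by
  set ε : ℝ := 1 / (1 + κ) with hε
  have hpos : 0 < ε := by positivity
  have step : ∀ n : ℕ, ∃ X : ℝ → EuclideanSpace ℝ (Fin N), X 0 = x ∧
      ∀ t ∈ Ioo (-((n + 1) * (ε / 2))) ((n + 1) * (ε / 2)), HasDerivAt X (F (X t)) t := by
    intro n
    induction n with
    | zero =>
      obtain ⟨X, h0, hX⟩ := exists_local_curve hF x 0
      refine ⟨X, h0, fun t ht => hX t ⟨?_, ?_⟩⟩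
      · have := ht.1
        simp only [← hε]
        push_cast at this
        linarith
      · have := ht.2
        simp only [← hε]
        push_cast at this
        linarith
    | succ n ih =>
      obtain ⟨X, h0, hX⟩ := ih
      set T : ℝ := (n + 1) * (ε / 2) with hT
      have hn : (0 : ℝ) ≤ n := n.cast_nonneg
      have hTε : ε / 2 ≤ T := by rw [hT]; nlinarith
      obtain ⟨Y, hY0, hY⟩ := exists_local_curve hF (X (T - ε / 4)) (T - ε / 4)
      obtain ⟨W, hW0, hW⟩ := exists_local_curve hF (X (-T + ε / 4)) (-T + ε / 4)
      rw [← hε] at hY hW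
      obtain ⟨Z, hZX, -, hZ⟩ := curve_glue hF (a := -T) (b := T) (c := T - ε / 2)
        (d := T + ε / 2) (t₀ := T - ε / 4) (by linarith) (by linarith)
        ⟨by linarith, by linarith⟩ hX
        (fun t ht => hY t ⟨by linarith [ht.1], by linarith [ht.2]⟩) hY0.symm
      have hm : -T + ε / 4 ∈ Ioo (-T) T := ⟨by linarith, by linarith⟩
      obtain ⟨V, -, hVZ, hV⟩ := curve_glue hF (a := -T - ε / 2) (b := -T + ε / 2) (c := -T)
        (d := T + ε / 2) (t₀ := -T + ε / 4) (X := W) (Y := Z) (by linarith) (by linarith)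
        ⟨by linarith, by linarith⟩
        (fun t ht => hW t ⟨by linarith [ht.1], by linarith [ht.2]⟩) hZ
        (by rw [hW0, hZX _ hm])
      refine ⟨V, ?_, fun t ht => hV t ⟨?_, ?_⟩⟩
      · rw [hVZ 0 ⟨by linarith, by linarith⟩, hZX 0 ⟨by linarith, by linarith⟩, h0]
      · have := ht.1
        push_cast at this
        linarith
      · have := ht.2
        push_cast at this
        linarith
  choose X hX0 hX using step
  have hcomp : ∀ m n : ℕ, m ≤ n → ∀ t ∈ Ioo (-((m + 1) * (ε / 2))) ((m + 1) * (ε / 2)),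
      X m t = X n t := by
    intro m n hmn
    have hmn' : ((m : ℝ) + 1) * (ε / 2) ≤ (n + 1) * (ε / 2) := by gcongr
    have h1 : 0 < ((m : ℝ) + 1) * (ε / 2) := by positivity
    exact curve_unique hF (t₀ := 0) ⟨by linarith, by linarith⟩ (hX m)
      (fun t ht => hX n t ⟨by linarith [ht.1], by linarith [ht.2]⟩) (by rw [hX0, hX0])
  have hlarge : ∀ t : ℝ, ∃ n : ℕ, t ∈ Ioo (-((n + 1) * (ε / 2))) ((n + 1) * (ε / 2)) := by
    intro t
    obtain ⟨n, hn⟩ := exists_nat_gt (|t| / (ε / 2))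
    have h1 : |t| < n * (ε / 2) := (div_lt_iff₀ (by positivity)).1 hn
    have h2 := abs_lt.1 h1
    exact ⟨n, by nlinarith [h2.1], by nlinarith [h2.2]⟩
  choose k hk using hlarge
  have hk' : ∀ (n : ℕ) (t : ℝ), t ∈ Ioo (-((n + 1) * (ε / 2))) ((n + 1) * (ε / 2)) →
      X (k t) t = X n t := by
    intro n t ht
    rcases le_total (k t) n with h | h
    · exact hcomp _ _ h t (hk t)
    · exact (hcomp _ _ h t ht).symm
  refine ⟨fun t => X (k t) t, hX0 _, fun t => ?_⟩
  exact (hX (k t) t (hk t)).congr_of_eventuallyEq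
    (Filter.mem_of_superset (isOpen_Ioo.mem_nhds (hk t)) (hk' (k t)))

/-- The flow `Φ(x, t)` of the vector field `F`: `t ↦ flow F x t` is the solution of
`X'(t) = F (X t)`, `X 0 = x`. It exists and is unique for a Lipschitz field, see
`flow_zero`, `hasDerivAt_flow` and `eq_flow`. -/
noncomputable def flow {N : ℕ} (F : EuclideanSpace ℝ (Fin N) → EuclideanSpace ℝ (Fin N))
    (x : EuclideanSpace ℝ (Fin N)) : ℝ → EuclideanSpace ℝ (Fin N) :=
  Classical.epsilon fun X : ℝ → EuclideanSpace ℝ (Fin N) =>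
    X 0 = x ∧ ∀ t, HasDerivAt X (F (X t)) t

theorem flow_zero {N : ℕ} {F : EuclideanSpace ℝ (Fin N) → EuclideanSpace ℝ (Fin N)} {κ : ℝ≥0}
    (hF : LipschitzWith κ F) (x : EuclideanSpace ℝ (Fin N)) : flow F x 0 = x :=
  (Classical.epsilon_spec (exists_global_curve hF x)).1

theorem hasDerivAt_flow {N : ℕ} {F : EuclideanSpace ℝ (Fin N) → EuclideanSpace ℝ (Fin N)}
    {κ : ℝ≥0} (hF : LipschitzWith κ F) (x : EuclideanSpace ℝ (Fin N)) (t : ℝ) :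
    HasDerivAt (flow F x) (F (flow F x t)) t :=
  (Classical.epsilon_spec (exists_global_curve hF x)).2 t

theorem eq_flow {N : ℕ} {F : EuclideanSpace ℝ (Fin N) → EuclideanSpace ℝ (Fin N)} {κ : ℝ≥0}
    (hF : LipschitzWith κ F) {x : EuclideanSpace ℝ (Fin N)}
    {X : ℝ → EuclideanSpace ℝ (Fin N)} (h0 : X 0 = x)
    (hX : ∀ t, HasDerivAt X (F (X t)) t) : X = flow F x :=
  ODE_solution_unique_univ (v := fun _ => F) (s := fun _ => univ) (K := κ) (t₀ := 0)
    (fun _ => hF.lipschitzOnWith) (fun t => ⟨hX t, mem_univ _⟩)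
    (fun t => ⟨hasDerivAt_flow hF x t, mem_univ _⟩) (by rw [h0, flow_zero hF])

/-! ### Stay times -/

/-- The forward stay time `τ₊(x) = inf {s > 0 | Φ(x, s) ∉ Ω} ∈ [0, ∞]`, with `inf ∅ = ∞`. -/
noncomputable def tauPlus {N : ℕ} (F : EuclideanSpace ℝ (Fin N) → EuclideanSpace ℝ (Fin N))
    (Ω : Set (EuclideanSpace ℝ (Fin N))) (x : EuclideanSpace ℝ (Fin N)) : EReal :=
  sInf {r : EReal | ∃ s : ℝ, 0 < s ∧ flow F x s ∉ Ω ∧ r = (s : EReal)}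

/-- The backward stay time `τ₋(x) = inf {s > 0 | Φ(x, -s) ∉ Ω} ∈ [0, ∞]`, with `inf ∅ = ∞`. -/
noncomputable def tauMinus {N : ℕ} (F : EuclideanSpace ℝ (Fin N) → EuclideanSpace ℝ (Fin N))
    (Ω : Set (EuclideanSpace ℝ (Fin N))) (x : EuclideanSpace ℝ (Fin N)) : EReal :=
  sInf {r : EReal | ∃ s : ℝ, 0 < s ∧ flow F x (-s) ∉ Ω ∧ r = (s : EReal)}

/-- The interval `(-τ₋(x), τ₊(x))`. -/
def stayInterval {N : ℕ} (F : EuclideanSpace ℝ (Fin N) → EuclideanSpace ℝ (Fin N))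
    (Ω : Set (EuclideanSpace ℝ (Fin N))) (x : EuclideanSpace ℝ (Fin N)) : Set ℝ :=
  {t : ℝ | -tauMinus F Ω x < (t : EReal) ∧ (t : EReal) < tauPlus F Ω x}

/-! ### Test functions

Functions on `Ω` are represented by functions on the whole space whose values outside `Ω` are
never used. -/

/-- The support in `Ω` of a function `ψ` on `Ω`: the complement in `Ω` of the largest open subset
of `Ω` on which `ψ` vanishes `μ`-almost everywhere. -/
def supp {N : ℕ} (Ω : Set (EuclideanSpace ℝ (Fin N))) (μ : Measure (EuclideanSpace ℝ (Fin N)))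
    (ψ : EuclideanSpace ℝ (Fin N) → ℝ) : Set (EuclideanSpace ℝ (Fin N)) :=
  Ω \ ⋃₀ {U : Set (EuclideanSpace ℝ (Fin N)) |
    IsOpen U ∧ U ⊆ Ω ∧ ∀ᵐ x ∂μ.restrict U, ψ x = 0}

/-- The derivative of `ψ` along the characteristic curve through `x`, that is
`d/ds ψ(Φ(x, s))` at `s = 0`. -/
noncomputable def alongDeriv {N : ℕ}
    (F : EuclideanSpace ℝ (Fin N) → EuclideanSpace ℝ (Fin N))
    (ψ : EuclideanSpace ℝ (Fin N) → ℝ) (x : EuclideanSpace ℝ (Fin N)) : ℝ :=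
  deriv (fun s : ℝ => ψ (flow F x s)) 0

/-- The test functions: measurable bounded functions on `Ω` with compact support in `Ω`, which are
continuously differentiable along every characteristic curve, the derivative along the
characteristics being measurable and bounded on `Ω`. Here `𝓜` is the collection of the sets
that count as measurable (the Borel sets, or the sets measurable for the completion of `μ`). -/
structure IsTestFunction {N : ℕ} (F : EuclideanSpace ℝ (Fin N) → EuclideanSpace ℝ (Fin N))
    (Ω : Set (EuclideanSpace ℝ (Fin N))) (μ : Measure (EuclideanSpace ℝ (Fin N)))
    (𝓜 : Set (Set (EuclideanSpace ℝ (Fin N))))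
    (ψ : EuclideanSpace ℝ (Fin N) → ℝ) : Prop where
  measurable : ∀ B : Set ℝ, MeasurableSet B → Ω.indicator ψ ⁻¹' B ∈ 𝓜
  bounded : ∃ C : ℝ, ∀ x ∈ Ω, |ψ x| ≤ C
  compact_supp : IsCompact (supp Ω μ ψ)
  contDiffOn : ∀ x ∈ Ω, ContDiffOn ℝ 1 (fun s : ℝ => ψ (flow F x s)) (stayInterval F Ω x)
  deriv_measurable : ∀ B : Set ℝ, MeasurableSet B → Ω.indicator (alongDeriv F ψ) ⁻¹' B ∈ 𝓜
  deriv_bounded : ∃ C : ℝ, ∀ x ∈ Ω, |alongDeriv F ψ x| ≤ C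

/-! ### The maximal transport operator -/

/-- `g ∈ L¹(Ω, μ)` satisfies `∫ g ψ dμ = ∫ f (d/ds ψ(Φ(x, s)))|_{s = 0} dμ` over `Ω` for all
test functions `ψ`. -/
def IsWeakTransport {N : ℕ} (F : EuclideanSpace ℝ (Fin N) → EuclideanSpace ℝ (Fin N))
    (Ω : Set (EuclideanSpace ℝ (Fin N))) (μ : Measure (EuclideanSpace ℝ (Fin N)))
    (𝓜 : Set (Set (EuclideanSpace ℝ (Fin N))))
    (f g : EuclideanSpace ℝ (Fin N) → ℝ) : Prop :=
  IntegrableOn g Ω μ ∧ ∀ ψ : EuclideanSpace ℝ (Fin N) → ℝ, IsTestFunction F Ω μ 𝓜 ψ →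
    ∫ x in Ω, g x * ψ x ∂μ = ∫ x in Ω, f x * alongDeriv F ψ x ∂μ

/-- The domain of the maximal transport operator. -/
def domTmax {N : ℕ} (F : EuclideanSpace ℝ (Fin N) → EuclideanSpace ℝ (Fin N))
    (Ω : Set (EuclideanSpace ℝ (Fin N))) (μ : Measure (EuclideanSpace ℝ (Fin N)))
    (𝓜 : Set (Set (EuclideanSpace ℝ (Fin N)))) : Set (EuclideanSpace ℝ (Fin N) → ℝ) :=
  {f | IntegrableOn f Ω μ ∧ ∃ g, IsWeakTransport F Ω μ 𝓜 f g}

/-- The maximal transport operator: `Tmax f` is the function `g` of `IsWeakTransport`, which is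
unique up to a `μ`-null set (see `isWeakTransport_unique`) and exists for `f` in the domain. -/
noncomputable def Tmax {N : ℕ} (F : EuclideanSpace ℝ (Fin N) → EuclideanSpace ℝ (Fin N))
    (Ω : Set (EuclideanSpace ℝ (Fin N))) (μ : Measure (EuclideanSpace ℝ (Fin N)))
    (𝓜 : Set (Set (EuclideanSpace ℝ (Fin N))))
    (f : EuclideanSpace ℝ (Fin N) → ℝ) : EuclideanSpace ℝ (Fin N) → ℝ :=
  Classical.epsilon fun g : EuclideanSpace ℝ (Fin N) → ℝ => IsWeakTransport F Ω μ 𝓜 f g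

theorem isWeakTransport_Tmax {N : ℕ}
    {F : EuclideanSpace ℝ (Fin N) → EuclideanSpace ℝ (Fin N)}
    {Ω : Set (EuclideanSpace ℝ (Fin N))} {μ : Measure (EuclideanSpace ℝ (Fin N))}
    {𝓜 : Set (Set (EuclideanSpace ℝ (Fin N)))}
    {f : EuclideanSpace ℝ (Fin N) → ℝ} (hf : f ∈ domTmax F Ω μ 𝓜) :
    IsWeakTransport F Ω μ 𝓜 f (Tmax F Ω μ 𝓜 f) :=
  Classical.epsilon_spec hf.2

/-- Smooth functions with compact support in `Ω` are test functions. -/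
theorem isTestFunction_of_contDiff {N : ℕ}
    {F : EuclideanSpace ℝ (Fin N) → EuclideanSpace ℝ (Fin N)} {κ : ℝ≥0} (hF : LipschitzWith κ F)
    {Ω : Set (EuclideanSpace ℝ (Fin N))} (hΩ : IsOpen Ω)
    {μ : Measure (EuclideanSpace ℝ (Fin N))}
    {𝓜 : Set (Set (EuclideanSpace ℝ (Fin N)))}
    (h𝓜 : ∀ A : Set (EuclideanSpace ℝ (Fin N)), MeasurableSet A → A ∈ 𝓜)
    {ψ : EuclideanSpace ℝ (Fin N) → ℝ} (hψ : ContDiff ℝ 1 ψ) (hc : HasCompactSupport ψ)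
    (hs : tsupport ψ ⊆ Ω) : IsTestFunction F Ω μ 𝓜 ψ := by
  have hd : ∀ x s, HasDerivAt (fun s : ℝ => ψ (flow F x s))
      (fderiv ℝ ψ (flow F x s) (F (flow F x s))) s := fun x s =>
    ((hψ.differentiable one_ne_zero) _).hasFDerivAt.comp_hasDerivAt s (hasDerivAt_flow hF x s)
  have hal : alongDeriv F ψ = fun x => fderiv ℝ ψ x (F x) := by
    funext x
    rw [alongDeriv, (hd x 0).deriv, flow_zero hF]
  have hcont : Continuous fun x => fderiv ℝ ψ x (F x) :=
    (hψ.continuous_fderiv one_ne_zero).clm_apply hF.continuous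
  have hcs : HasCompactSupport fun x => fderiv ℝ ψ x (F x) := by
    refine (hc.fderiv (𝕜 := ℝ)).mono fun x hx => ?_
    simp only [Function.mem_support, ne_eq] at hx ⊢
    intro h
    exact hx (by rw [h]; rfl)
  have hmeas : ∀ u : EuclideanSpace ℝ (Fin N) → ℝ, Continuous u →
      ∀ B : Set ℝ, MeasurableSet B → Ω.indicator u ⁻¹' B ∈ 𝓜 := fun u hu B hB =>
    h𝓜 _ ((hu.measurable.indicator hΩ.measurableSet) hB)
  refine ⟨hmeas ψ hψ.continuous, ?_, ?_, ?_, ?_, ?_⟩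
  · obtain ⟨C, hC⟩ := hc.exists_bound_of_continuous hψ.continuous
    exact ⟨C, fun x _ => hC x⟩
  · have hopen : IsOpen (⋃₀ {U : Set (EuclideanSpace ℝ (Fin N)) |
        IsOpen U ∧ U ⊆ Ω ∧ ∀ᵐ x ∂μ.restrict U, ψ x = 0}) := isOpen_sUnion fun U hU => hU.1
    have hsub : Ω \ tsupport ψ ⊆ ⋃₀ {U : Set (EuclideanSpace ℝ (Fin N)) |
        IsOpen U ∧ U ⊆ Ω ∧ ∀ᵐ x ∂μ.restrict U, ψ x = 0} := by
      have ho : IsOpen (Ω \ tsupport ψ) := hΩ.sdiff (isClosed_tsupport ψ)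
      refine subset_sUnion_of_mem ⟨ho, sdiff_subset, ?_⟩
      exact ae_restrict_of_forall_mem ho.measurableSet fun x hx => image_eq_zero_of_notMem_tsupport hx.2
    have heq : supp Ω μ ψ = tsupport ψ \ ⋃₀ {U : Set (EuclideanSpace ℝ (Fin N)) |
        IsOpen U ∧ U ⊆ Ω ∧ ∀ᵐ x ∂μ.restrict U, ψ x = 0} := by
      ext x
      constructor
      · rintro ⟨h1, h2⟩
        exact ⟨by_contra fun h => h2 (hsub ⟨h1, h⟩), h2⟩
      · rintro ⟨h1, h2⟩
        exact ⟨hs h1, h2⟩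
    rw [heq]
    exact IsCompact.diff hc hopen
  · intro x _
    refine ContDiff.contDiffOn (contDiff_one_iff_deriv.2 ⟨fun s => (hd x s).differentiableAt, ?_⟩)
    have : deriv (fun s : ℝ => ψ (flow F x s)) =
        fun s => fderiv ℝ ψ (flow F x s) (F (flow F x s)) := funext fun s => (hd x s).deriv
    rw [this]
    exact hcont.comp (continuous_iff_continuousAt.2 fun s => (hasDerivAt_flow hF x s).continuousAt)
  · rw [hal]
    exact hmeas _ hcont
  · rw [hal]
    obtain ⟨C, hC⟩ := hcs.exists_bound_of_continuous hcont
    exact ⟨C, fun x _ => hC x⟩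

/-- `Tmax f` is well defined up to a `μ`-null set. -/
theorem isWeakTransport_unique {N : ℕ}
    {F : EuclideanSpace ℝ (Fin N) → EuclideanSpace ℝ (Fin N)} {κ : ℝ≥0} (hF : LipschitzWith κ F)
    {Ω : Set (EuclideanSpace ℝ (Fin N))} (hΩ : IsOpen Ω)
    {μ : Measure (EuclideanSpace ℝ (Fin N))}
    {𝓜 : Set (Set (EuclideanSpace ℝ (Fin N)))}
    (h𝓜 : ∀ A : Set (EuclideanSpace ℝ (Fin N)), MeasurableSet A → A ∈ 𝓜)
    {f g g' : EuclideanSpace ℝ (Fin N) → ℝ} (h : IsWeakTransport F Ω μ 𝓜 f g)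
    (h' : IsWeakTransport F Ω μ 𝓜 f g') : g =ᵐ[μ.restrict Ω] g' := by
  have key := hΩ.ae_eq_zero_of_integral_contDiff_smul_eq_zero (μ := μ) (f := fun x => g x - g' x)
    (h.1.sub h'.1).locallyIntegrableOn (by
      intro ψ hψ hc hs
      have ht : IsTestFunction F Ω μ 𝓜 ψ :=
        isTestFunction_of_contDiff hF hΩ h𝓜 (hψ.of_le (by norm_cast)) hc hs
      obtain ⟨C, hC⟩ := hc.exists_bound_of_continuous hψ.continuous
      have hi : ∀ u : EuclideanSpace ℝ (Fin N) → ℝ, IntegrableOn u Ω μ →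
          IntegrableOn (fun x => u x * ψ x) Ω μ := fun u hu =>
        Integrable.mul_bdd hu hψ.continuous.aestronglyMeasurable (c := C) (ae_of_all _ hC)
      have h0 : ∫ x in Ω, ψ x • (g x - g' x) ∂μ = ∫ x, ψ x • (g x - g' x) ∂μ := by
        refine setIntegral_eq_integral_of_forall_compl_eq_zero fun x hx => ?_
        rw [image_eq_zero_of_notMem_tsupport fun h => hx (hs h), zero_smul]
      rw [← h0]
      have h1 : ∀ x, ψ x • (g x - g' x) = g x * ψ x - g' x * ψ x := fun x => by
        rw [smul_eq_mul]; ring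
      simp only [h1]
      rw [integral_sub (hi g h.1) (hi g' h'.1), h.2 ψ ht, h'.2 ψ ht, sub_self])
  rw [EventuallyEq, ae_restrict_iff' hΩ.measurableSet]
  filter_upwards [key] with x hx hm
  exact sub_eq_zero.1 (hx hm)

/-! ### The mild formulation -/

/-- Some representative `f'` of `f` satisfies, for `μ`-almost every `x ∈ Ω` and all
`-τ₋(x) < t₁ ≤ t₂ < τ₊(x)`, `f'(Φ(x, t₁)) - f'(Φ(x, t₂)) = ∫_{t₁}^{t₂} g(Φ(x, s)) ds`, the
integrand being integrable. -/
def HasMildForm {N : ℕ} (F : EuclideanSpace ℝ (Fin N) → EuclideanSpace ℝ (Fin N))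
    (Ω : Set (EuclideanSpace ℝ (Fin N))) (μ : Measure (EuclideanSpace ℝ (Fin N)))
    (f g : EuclideanSpace ℝ (Fin N) → ℝ) : Prop :=
  ∃ f' : EuclideanSpace ℝ (Fin N) → ℝ, f' =ᵐ[μ.restrict Ω] f ∧
    ∀ᵐ x ∂μ.restrict Ω, ∀ t₁ t₂ : ℝ, -tauMinus F Ω x < (t₁ : EReal) → t₁ ≤ t₂ →
      (t₂ : EReal) < tauPlus F Ω x →
        IntervalIntegrable (fun s : ℝ => g (flow F x s)) volume t₁ t₂ ∧
          f' (flow F x t₁) - f' (flow F x t₂) = ∫ s in t₁..t₂, g (flow F x s)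

end Transport

namespace Transport

/-! ### The flow as a jointly continuous group of homeomorphisms. -/

section Flow

variable {N : ℕ} {F : EuclideanSpace ℝ (Fin N) → EuclideanSpace ℝ (Fin N)} {κ : ℝ≥0}

/-! Write Φ_t for the time-t map of the flow. Since Φ_t preserves μ, composition with Φ_t has
composition with Φ_{-t} as its adjoint. Hence integrating a function forwards along trajectories is
adjoint to integrating its partner backwards (`integral_mul_integral_flow_comm`). Both implications
rest on this duality. Openness of Ω and compact supports guarantee that the trajectories involved do
not leave Ω.

Weak to mild: fix t and let ψ be smooth with compact support in the open set of points whose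
trajectory stays in Ω between the times 0 and t. The backward integral of ψ over the time t is a
test function, and its derivative along the flow is ψ - ψ∘Φ_{-t}. Inserting it in the weak
formulation and moving the flow to the other factors shows that f - f∘Φ_t - ∫₀ᵗ g∘Φ_s ds is
orthogonal to every such ψ, so it vanishes almost everywhere on that set
(`IsWeakTransport.ae_sub_eq_integral`). The exceptional set depends on t. By Fubini, for almost
every x the function t ↦ f(Φ(x,t)) + ∫₀ᵗ g(Φ(x,s)) ds equals f(x) for almost every t. The
representative of f assigns to each point this almost sure constant of its own trajectory. The
constant changes by exactly the integral of g when the starting point moves along the trajectory, so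
the mild identity holds at all times (`AEConstAlong.flow`).

Mild to weak: let v be a test function ψ extended by zero. Integrating the mild identity against v
and moving the flow onto v gives ∫ f (v∘Φ_t - v) dμ = t ∫₀¹ ∫ g v∘Φ_{rt} dμ dr for small t
(`integral_mul_sub_of_mild`). Dividing by t and letting t → 0 yields the weak formulation by
dominated convergence.

The identification g = `Tmax` f follows because the weak formulation determines g up to a null set.
-/

theorem continuous_flow_right (hF : LipschitzWith κ F) (x : EuclideanSpace ℝ (Fin N)) :
    Continuous (flow F x) :=
  continuous_iff_continuousAt.2 fun s => (hasDerivAt_flow hF x s).continuousAt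

/-- The group law of the flow. -/
theorem flow_flow (hF : LipschitzWith κ F) (x : EuclideanSpace ℝ (Fin N)) (s t : ℝ) :
    flow F (flow F x s) t = flow F x (s + t) := by
  have h := eq_flow hF (x := flow F x s) (X := fun t => flow F x (s + t)) (by simp)
    (fun t => (hasDerivAt_flow hF x (s + t)).comp_const_add s t)
  exact (congrFun h t).symm

theorem flow_flow_neg (hF : LipschitzWith κ F) (x : EuclideanSpace ℝ (Fin N)) (t : ℝ) :
    flow F (flow F x t) (-t) = x := by
  rw [flow_flow hF, add_neg_cancel, flow_zero hF]

theorem flow_neg_flow (hF : LipschitzWith κ F) (x : EuclideanSpace ℝ (Fin N)) (t : ℝ) :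
    flow F (flow F x (-t)) t = x := by
  rw [flow_flow hF, neg_add_cancel, flow_zero hF]

/-- Reversing the vector field reverses time. -/
theorem flow_neg_field (hF : LipschitzWith κ F) (x : EuclideanSpace ℝ (Fin N)) (t : ℝ) :
    flow (fun y => -F y) x t = flow F x (-t) := by
  have h := eq_flow (F := fun y => -F y) (κ := κ) hF.neg (x := x) (X := fun t => flow F x (-t))
    (by simp [flow_zero hF])
    (fun t => by
      have := (hasDerivAt_flow hF x (-t)).scomp t (hasDerivAt_neg t)
      simpa [Function.comp_def] using this)
  exact (congrFun h t).symm

/-- Grönwall's inequality; negative times are reached below by reversing the field. -/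
theorem dist_flow_le_of_nonneg (hF : LipschitzWith κ F) (x y : EuclideanSpace ℝ (Fin N)) {t : ℝ}
    (ht : 0 ≤ t) : dist (flow F x t) (flow F y t) ≤ dist x y * Real.exp (κ * t) := by
  have h := dist_le_of_trajectories_ODE (v := fun _ => F) (K := κ) (f := flow F x) (g := flow F y)
    (a := 0) (b := t) (δ := dist x y) (fun _ => hF)
    (continuous_flow_right hF x).continuousOn
    (fun s _ => (hasDerivAt_flow hF x s).hasDerivWithinAt)
    (continuous_flow_right hF y).continuousOn
    (fun s _ => (hasDerivAt_flow hF y s).hasDerivWithinAt)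
    (by rw [flow_zero hF, flow_zero hF]) t ⟨ht, le_rfl⟩
  simpa using h

theorem dist_flow_le (hF : LipschitzWith κ F) (x y : EuclideanSpace ℝ (Fin N)) (t : ℝ) :
    dist (flow F x t) (flow F y t) ≤ dist x y * Real.exp (κ * |t|) := by
  rcases le_total 0 t with ht | ht
  · rw [abs_of_nonneg ht]
    exact dist_flow_le_of_nonneg hF x y ht
  · rw [abs_of_nonpos ht]
    have h := dist_flow_le_of_nonneg (F := fun y => -F y) hF.neg x y (neg_nonneg.2 ht)
    rwa [flow_neg_field hF, flow_neg_field hF, neg_neg] at h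

/-- The flow depends continuously on time and the initial point. -/
theorem continuous_flow (hF : LipschitzWith κ F) :
    Continuous fun p : ℝ × EuclideanSpace ℝ (Fin N) => flow F p.2 p.1 := by
  refine continuous_iff_continuousAt.2 fun p => ?_
  rw [ContinuousAt, tendsto_iff_dist_tendsto_zero]
  have h : Tendsto (fun q : ℝ × EuclideanSpace ℝ (Fin N) =>
      dist q.2 p.2 * Real.exp (κ * |q.1|) + dist (flow F p.2 q.1) (flow F p.2 p.1)) (𝓝 p)
      (𝓝 0) := by
    have hc : Continuous (fun q : ℝ × EuclideanSpace ℝ (Fin N) =>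
        dist q.2 p.2 * Real.exp (κ * |q.1|) + dist (flow F p.2 q.1) (flow F p.2 p.1)) := by
      have := (continuous_flow_right hF p.2).comp
        (continuous_fst (X := ℝ) (Y := EuclideanSpace ℝ (Fin N)))
      simp only [Function.comp_def] at this
      fun_prop
    simpa using hc.tendsto p
  refine squeeze_zero (fun _ => dist_nonneg) (fun q => ?_) h
  refine (dist_triangle _ (flow F p.2 q.1) _).trans ?_
  gcongr
  exact dist_flow_le hF _ _ _

theorem continuous_flow_comp {X : Type*} [TopologicalSpace X] (hF : LipschitzWith κ F) {u : X → ℝ}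
    {v : X → EuclideanSpace ℝ (Fin N)} (hv : Continuous v) (hu : Continuous u) :
    Continuous fun a => flow F (v a) (u a) :=
  (continuous_flow hF).comp (hu.prodMk hv)

/-! ### Flow-invariant measures -/

/-- The time-`t` map of the flow preserves a flow-invariant measure. -/
theorem measurePreserving_flow (hF : LipschitzWith κ F) {μ : Measure (EuclideanSpace ℝ (Fin N))}
    (hμ : ∀ (t : ℝ) (A : Set (EuclideanSpace ℝ (Fin N))), MeasurableSet A →
      μ ((fun x => flow F x t) '' A) = μ A) (t : ℝ) :
    MeasurePreserving (fun x => flow F x t) μ μ := by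
  have hm : Measurable fun x => flow F x t :=
    (continuous_flow_comp hF continuous_id continuous_const).measurable
  refine ⟨hm, Measure.ext fun A hA => ?_⟩
  -- The preimage of a set under Φ_t is its image under Φ_{-t}.
  rw [Measure.map_apply hm hA, ← hμ (-t) A hA]
  congr 1
  ext x
  constructor
  · exact fun hx => ⟨_, hx, flow_flow_neg hF x t⟩
  · rintro ⟨y, hy, rfl⟩
    simpa [flow_neg_flow hF] using hy

/-- The map `(s, x) ↦ (s, Φ(x, θ s))` preserves the product of any measure on the line with a
flow-invariant measure. -/
theorem measurePreserving_shear (hF : LipschitzWith κ F) {μ : Measure (EuclideanSpace ℝ (Fin N))}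
    [SFinite μ] (hμ : ∀ t, MeasurePreserving (fun x => flow F x t) μ μ) (ν : Measure ℝ) [SFinite ν] {θ : ℝ → ℝ}
    (hθ : Continuous θ) :
    MeasurePreserving (fun p : ℝ × EuclideanSpace ℝ (Fin N) => (p.1, flow F p.2 (θ p.1)))
      (ν.prod μ) (ν.prod μ) :=
  (MeasurePreserving.id ν).skew_product (g := fun s x => flow F x (θ s))
    (continuous_flow_comp hF continuous_snd (hθ.comp continuous_fst)).measurable
    (ae_of_all _ fun s => (hμ (θ s)).map_eq)

/-! ### Points whose trajectory stays in `Ω` -/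

/-- The points whose trajectory between the times `0` and `t` stays in `Ω`. -/
def stayDomain (F : EuclideanSpace ℝ (Fin N) → EuclideanSpace ℝ (Fin N))
    (Ω : Set (EuclideanSpace ℝ (Fin N))) (t : ℝ) : Set (EuclideanSpace ℝ (Fin N)) :=
  {x | ∀ r ∈ Icc (0 : ℝ) 1, flow F x (r * t) ∈ Ω}

theorem isOpen_setOf_mem_stayDomain (hF : LipschitzWith κ F)
    {Ω : Set (EuclideanSpace ℝ (Fin N))} (hΩ : IsOpen Ω) :
    IsOpen {p : ℝ × EuclideanSpace ℝ (Fin N) | p.2 ∈ stayDomain F Ω p.1} := by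
  refine isOpen_iff_eventually.2 fun p hp => ?_
  -- Tube lemma: scaling time to r ∈ [0, 1] gives one compact parameter set for all t.
  refine isCompact_Icc.eventually_forall_of_forall_eventually fun r hr => ?_
  have hc : Continuous fun q : (ℝ × EuclideanSpace ℝ (Fin N)) × ℝ =>
      flow F q.1.2 (q.2 * q.1.1) :=
    continuous_flow_comp hF (by fun_prop) (by fun_prop)
  exact hc.continuousAt.eventually_mem (hΩ.mem_nhds (hp r hr))

theorem isOpen_stayDomain (hF : LipschitzWith κ F)
    {Ω : Set (EuclideanSpace ℝ (Fin N))} (hΩ : IsOpen Ω) (t : ℝ) : IsOpen (stayDomain F Ω t) :=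
  (isOpen_setOf_mem_stayDomain hF hΩ).preimage (Continuous.prodMk_right t)

theorem stayDomain_subset (hF : LipschitzWith κ F) (Ω : Set (EuclideanSpace ℝ (Fin N))) (t : ℝ) :
    stayDomain F Ω t ⊆ Ω := fun x hx => by
  simpa [flow_zero hF] using hx 0 (by simp)

theorem mem_stayDomain_iff {Ω : Set (EuclideanSpace ℝ (Fin N))} {t : ℝ}
    {x : EuclideanSpace ℝ (Fin N)} :
    x ∈ stayDomain F Ω t ↔ ∀ s ∈ uIcc 0 t, flow F x s ∈ Ω := by
  have h : uIcc 0 t = (fun r => r * t) '' Icc (0 : ℝ) 1 := by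
    rw [← segment_eq_uIcc, segment_eq_image]
    simp
  rw [h, forall_mem_image]
  rfl

/-- The trajectory through `y = Φ(x, t)`, followed for the time `-t`, is the one from `x`,
followed for the time `t`. -/
theorem flow_mem_stayDomain_neg (hF : LipschitzWith κ F) {Ω : Set (EuclideanSpace ℝ (Fin N))}
    {t : ℝ} {x : EuclideanSpace ℝ (Fin N)} :
    flow F x t ∈ stayDomain F Ω (-t) ↔ x ∈ stayDomain F Ω t := by
  have h : ∀ r, flow F (flow F x t) (r * -t) = flow F x ((1 - r) * t) := fun r => by
    rw [flow_flow hF]; congr 1; ring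
  simp only [stayDomain, mem_ofPred_eq, h]
  constructor
  · intro H r hr
    simpa using H (1 - r) ⟨by linarith [hr.2], by linarith [hr.1]⟩
  · exact fun H r hr => H (1 - r) ⟨by linarith [hr.2], by linarith [hr.1]⟩

/-- Openness of Ω makes the inequality strict: a trajectory that is in Ω at time t remains there a
little longer. -/
theorem lt_tauPlus_iff (hF : LipschitzWith κ F) {Ω : Set (EuclideanSpace ℝ (Fin N))}
    (hΩ : IsOpen Ω) {x : EuclideanSpace ℝ (Fin N)} (hx : x ∈ Ω) {t : ℝ} :
    (t : EReal) < tauPlus F Ω x ↔ ∀ s ∈ Icc 0 t, flow F x s ∈ Ω := by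
  constructor
  · intro h s hs
    rcases hs.1.eq_or_lt with rfl | h0
    · rwa [flow_zero hF]
    · by_contra hn
      have h1 : tauPlus F Ω x ≤ (s : EReal) := sInf_le ⟨s, h0, hn, rfl⟩
      exact absurd (h.trans_le h1) (not_lt.2 (EReal.coe_le_coe_iff.2 hs.2))
  · intro h
    -- For t < 0 the hypothesis is void and the margin is taken beyond time 0 instead.
    have hm : flow F x (max t 0) ∈ Ω := by
      rcases le_total t 0 with h0 | h0
      · rwa [max_eq_right h0, flow_zero hF]
      · rw [max_eq_left h0]; exact h t ⟨h0, le_rfl⟩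
    obtain ⟨ε, hε, hb⟩ := Metric.eventually_nhds_iff.1
      ((continuous_flow_right hF x).continuousAt.eventually_mem (hΩ.mem_nhds hm))
    have hlt : (t : EReal) < ((max t 0 + ε : ℝ) : EReal) :=
      EReal.coe_lt_coe_iff.2 (by linarith [le_max_left t 0])
    refine hlt.trans_le (le_sInf ?_)
    rintro _ ⟨s, hs, hsn, rfl⟩
    refine EReal.coe_le_coe_iff.2 (not_lt.1 fun hlt => hsn ?_)
    rcases le_total s t with hst | hst
    · exact h s ⟨hs.le, hst⟩
    · refine hb ?_
      have : max t 0 ≤ s := max_le hst hs.le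
      rw [Real.dist_eq, abs_of_nonneg (by linarith)]
      linarith

theorem tauMinus_eq (hF : LipschitzWith κ F) (Ω : Set (EuclideanSpace ℝ (Fin N)))
    (x : EuclideanSpace ℝ (Fin N)) : tauMinus F Ω x = tauPlus (fun y => -F y) Ω x := by
  simp only [tauMinus, tauPlus, flow_neg_field hF]

theorem neg_tauMinus_lt_iff (hF : LipschitzWith κ F) {Ω : Set (EuclideanSpace ℝ (Fin N))}
    (hΩ : IsOpen Ω) {x : EuclideanSpace ℝ (Fin N)} (hx : x ∈ Ω) {t : ℝ} :
    -tauMinus F Ω x < (t : EReal) ↔ ∀ s ∈ Icc t 0, flow F x s ∈ Ω := by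
  rw [EReal.neg_lt_comm, ← EReal.coe_neg, tauMinus_eq hF,
    lt_tauPlus_iff (F := fun y => -F y) hF.neg hΩ hx]
  simp only [flow_neg_field hF]
  constructor
  · intro h s hs
    simpa using h (-s) ⟨by linarith [hs.2], by linarith [hs.1]⟩
  · exact fun h s hs => h (-s) ⟨by linarith [hs.2], by linarith [hs.1]⟩

/-- The stay interval of `x` consists of the times `t` for which the trajectory between `0` and
`t` stays in `Ω`. -/
theorem mem_stayInterval_iff (hF : LipschitzWith κ F) {Ω : Set (EuclideanSpace ℝ (Fin N))}
    (hΩ : IsOpen Ω) {x : EuclideanSpace ℝ (Fin N)} (hx : x ∈ Ω) {t : ℝ} :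
    t ∈ stayInterval F Ω x ↔ x ∈ stayDomain F Ω t := by
  rw [mem_stayDomain_iff, stayInterval, mem_ofPred_eq, neg_tauMinus_lt_iff hF hΩ hx,
    lt_tauPlus_iff hF hΩ hx]
  constructor
  · intro H s hs
    rcases mem_uIcc.1 hs with h | h
    · exact H.2 s h
    · exact H.1 s h
  · exact fun H => ⟨fun s hs => H s (Icc_subset_uIcc' hs), fun s hs => H s (Icc_subset_uIcc hs)⟩

theorem isOpen_stayInterval (hF : LipschitzWith κ F) {Ω : Set (EuclideanSpace ℝ (Fin N))}
    (hΩ : IsOpen Ω) {x : EuclideanSpace ℝ (Fin N)} (hx : x ∈ Ω) :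
    IsOpen (stayInterval F Ω x) := by
  have h : stayInterval F Ω x = (fun t : ℝ => (t, x)) ⁻¹'
      {p : ℝ × EuclideanSpace ℝ (Fin N) | p.2 ∈ stayDomain F Ω p.1} := by
    ext t
    exact mem_stayInterval_iff hF hΩ hx
  rw [h]
  exact (isOpen_setOf_mem_stayDomain hF hΩ).preimage (Continuous.prodMk_left x)

theorem zero_mem_stayInterval (hF : LipschitzWith κ F) {Ω : Set (EuclideanSpace ℝ (Fin N))}
    (hΩ : IsOpen Ω) {x : EuclideanSpace ℝ (Fin N)} (hx : x ∈ Ω) : 0 ∈ stayInterval F Ω x :=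
  (mem_stayInterval_iff hF hΩ hx).2 fun r _ => by simpa [flow_zero hF] using hx

theorem flow_mem_of_mem_stayInterval (hF : LipschitzWith κ F)
    {Ω : Set (EuclideanSpace ℝ (Fin N))} (hΩ : IsOpen Ω) {x : EuclideanSpace ℝ (Fin N)}
    (hx : x ∈ Ω) {t : ℝ} (ht : t ∈ stayInterval F Ω x) : flow F x t ∈ Ω := by
  simpa using (mem_stayInterval_iff hF hΩ hx).1 ht 1 (by simp)

theorem ordConnected_stayInterval (F : EuclideanSpace ℝ (Fin N) → EuclideanSpace ℝ (Fin N))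
    (Ω : Set (EuclideanSpace ℝ (Fin N))) (x : EuclideanSpace ℝ (Fin N)) :
    (stayInterval F Ω x).OrdConnected :=
  ⟨fun _ ha _ hb _ hc => ⟨ha.1.trans_le (EReal.coe_le_coe_iff.2 hc.1),
    (EReal.coe_le_coe_iff.2 hc.2).trans_lt hb.2⟩⟩

/-- Stay intervals translate along trajectories. -/
theorem mem_stayInterval_flow_iff (hF : LipschitzWith κ F) {Ω : Set (EuclideanSpace ℝ (Fin N))}
    (hΩ : IsOpen Ω) {x : EuclideanSpace ℝ (Fin N)} (hx : x ∈ Ω) {t s : ℝ}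
    (ht : t ∈ stayInterval F Ω x) :
    s ∈ stayInterval F Ω (flow F x t) ↔ t + s ∈ stayInterval F Ω x := by
  -- One implication suffices: the other is the same one started at Φ(x, t) with the time -t.
  have key : ∀ {y : EuclideanSpace ℝ (Fin N)}, y ∈ Ω → ∀ {a b : ℝ}, a ∈ stayInterval F Ω y →
      a + b ∈ stayInterval F Ω y → b ∈ stayInterval F Ω (flow F y a) := by
    intro y hy a b ha hab
    rw [mem_stayInterval_iff hF hΩ (flow_mem_of_mem_stayInterval hF hΩ hy ha)]
    intro r hr
    rw [flow_flow hF]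
    refine flow_mem_of_mem_stayInterval hF hΩ hy ?_
    have h := (ordConnected_stayInterval F Ω y).convex ha hab (sub_nonneg.2 hr.2) hr.1 (by ring)
    have e : (1 - r) • a + r • (a + b) = a + r * b := by simp only [smul_eq_mul]; ring
    rwa [e] at h
  refine ⟨fun h => ?_, key hx ht⟩
  have hy := flow_mem_of_mem_stayInterval hF hΩ hx ht
  have hn : -t ∈ stayInterval F Ω (flow F x t) :=
    (mem_stayInterval_iff hF hΩ hy).2
      ((flow_mem_stayDomain_neg hF).2 ((mem_stayInterval_iff hF hΩ hx).1 ht))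
  have := key hy hn (b := t + s) (by simpa using h)
  rwa [flow_flow_neg hF] at this

end Flow

/-! ### Time averages along trajectories and their duality. -/

section Average

variable {N : ℕ} {F : EuclideanSpace ℝ (Fin N) → EuclideanSpace ℝ (Fin N)} {κ : ℝ≥0}
  {μ : Measure (EuclideanSpace ℝ (Fin N))}

theorem ae_ae_of_ae_prod_swap {α β : Type*} [MeasurableSpace α] [MeasurableSpace β]
    {ν : Measure α} {μ : Measure β} [SFinite ν] [SFinite μ] {P : α × β → Prop}
    (h : ∀ᵐ p ∂ν.prod μ, P p) : ∀ᵐ y ∂μ, ∀ᵐ x ∂ν, P (x, y) :=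
  Measure.ae_ae_of_ae_prod (Measure.measurePreserving_swap.quasiMeasurePreserving.ae h)

theorem integral_mul_comp_flow_neg (hF : LipschitzWith κ F)
    (hμ : ∀ t, MeasurePreserving (fun x => flow F x t) μ μ)
    {u v : EuclideanSpace ℝ (Fin N) → ℝ} (hu : AEStronglyMeasurable u μ)
    (hv : AEStronglyMeasurable v μ) (t : ℝ) :
    ∫ x, u x * v (flow F x (-t)) ∂μ = ∫ x, u (flow F x t) * v x ∂μ := by
  have hm : AEStronglyMeasurable (fun x => u x * v (flow F x (-t))) μ :=
    hu.mul (hv.comp_quasiMeasurePreserving (hμ (-t)).quasiMeasurePreserving)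
  rw [← (hμ t).map_eq] at hm
  have h := integral_map (hμ t).measurable.aemeasurable hm
  rw [(hμ t).map_eq] at h
  simpa only [flow_flow_neg hF] using h

/-- Rescaling to (0, 1] makes the domain of integration independent of t and of its sign. Fubini,
joint measurability in t and the limit t → 0 then concern one fixed finite measure. -/
theorem integral_zero_eq_mul (w : ℝ → ℝ) (t : ℝ) :
    ∫ s in (0 : ℝ)..t, w s = t * ∫ r in Ioc (0 : ℝ) 1, w (r * t) := by
  rw [← intervalIntegral.integral_of_le zero_le_one,
    intervalIntegral.mul_integral_comp_mul_right, zero_mul, one_mul]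

variable [SFinite μ]

/-- Almost every trajectory meets a null set at a null set of times only. -/
theorem ae_ae_flow (hF : LipschitzWith κ F)
    (hμ : ∀ t, MeasurePreserving (fun x => flow F x t) μ μ)
    {P : EuclideanSpace ℝ (Fin N) → Prop} (h : ∀ᵐ x ∂μ, P x) :
    ∀ᵐ x ∂μ, ∀ᵐ s : ℝ, P (flow F x s) :=
  ae_ae_of_ae_prod_swap ((Measure.quasiMeasurePreserving_snd.comp
    (measurePreserving_shear hF hμ volume continuous_id).quasiMeasurePreserving).ae h)

theorem aestronglyMeasurable_comp_flow (hF : LipschitzWith κ F)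
    (hμ : ∀ t, MeasurePreserving (fun x => flow F x t) μ μ)
    {u : EuclideanSpace ℝ (Fin N) → ℝ} (hu : AEStronglyMeasurable u μ)
    (ν : Measure ℝ) [SFinite ν] {θ : ℝ → ℝ} (hθ : Continuous θ) :
    AEStronglyMeasurable (fun p : ℝ × EuclideanSpace ℝ (Fin N) => u (flow F p.2 (θ p.1)))
      (ν.prod μ) :=
  hu.comp_quasiMeasurePreserving (Measure.quasiMeasurePreserving_snd.comp
    (measurePreserving_shear hF hμ ν hθ).quasiMeasurePreserving)

theorem integrable_comp_flow (hF : LipschitzWith κ F)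
    (hμ : ∀ t, MeasurePreserving (fun x => flow F x t) μ μ)
    {u : EuclideanSpace ℝ (Fin N) → ℝ} (hu : Integrable u μ)
    (ν : Measure ℝ) [IsFiniteMeasure ν] {θ : ℝ → ℝ} (hθ : Continuous θ) :
    Integrable (fun p : ℝ × EuclideanSpace ℝ (Fin N) => u (flow F p.2 (θ p.1))) (ν.prod μ) :=
  ((measurePreserving_shear hF hμ ν hθ).integrable_comp (hu.comp_snd ν).1).2 (hu.comp_snd ν)

/-- An integrable function is locally integrable along almost every trajectory. -/
theorem ae_intervalIntegrable_flow (hF : LipschitzWith κ F)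
    (hμ : ∀ t, MeasurePreserving (fun x => flow F x t) μ μ)
    {u : EuclideanSpace ℝ (Fin N) → ℝ} (hu : Integrable u μ) :
    ∀ᵐ x ∂μ, ∀ a b : ℝ, IntervalIntegrable (fun s => u (flow F x s)) volume a b := by
  -- Fubini on [-n, n] × ℝ^N, then countably many n, so that one null set serves all intervals.
  have h : ∀ n : ℕ, ∀ᵐ x ∂μ,
      Integrable (fun s => u (flow F x s)) (volume.restrict (Icc (-n : ℝ) n)) := fun n =>
    (integrable_comp_flow hF hμ hu (volume.restrict (Icc (-n : ℝ) n)) continuous_id).prod_left_ae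
  filter_upwards [ae_all_iff.2 h] with x hx a b
  obtain ⟨n, hn⟩ := exists_nat_ge (max |a| |b|)
  have hi : IntegrableOn (fun s => u (flow F x s)) (Icc (-n : ℝ) n) := hx n
  refine (hi.mono_set ?_).intervalIntegrable
  have ha := abs_le.1 ((le_max_left _ _).trans hn)
  have hb := abs_le.1 ((le_max_right _ _).trans hn)
  exact uIcc_subset_Icc ha hb

/-- Moving a time average along trajectories from one factor of an integral to the other. -/
theorem integral_mul_integral_flow (hF : LipschitzWith κ F)
    (hμ : ∀ t, MeasurePreserving (fun x => flow F x t) μ μ)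
    {u v : EuclideanSpace ℝ (Fin N) → ℝ} (hu : Integrable u μ) (hv : AEStronglyMeasurable v μ)
    {C : ℝ} (hC : ∀ x, |v x| ≤ C) (t : ℝ) :
    ∫ x, v x * (∫ s in (0 : ℝ)..t, u (flow F x s)) ∂μ =
      t * ∫ p, v (flow F p.2 (-(p.1 * t))) * u p.2 ∂(volume.restrict (Ioc (0 : ℝ) 1)).prod μ := by
  set ν : Measure ℝ := volume.restrict (Ioc (0 : ℝ) 1)
  have hθ : Continuous fun r : ℝ => r * t := by fun_prop
  have hT := measurePreserving_shear hF hμ ν hθ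
  have hi : Integrable (fun p : ℝ × EuclideanSpace ℝ (Fin N) =>
      v p.2 * u (flow F p.2 (p.1 * t))) (ν.prod μ) :=
    (integrable_comp_flow hF hμ hu ν hθ).bdd_mul hv.comp_snd (ae_of_all _ fun p => hC p.2)
  have hm : AEStronglyMeasurable (fun p : ℝ × EuclideanSpace ℝ (Fin N) =>
      v (flow F p.2 (-(p.1 * t))) * u p.2) (ν.prod μ) :=
    (aestronglyMeasurable_comp_flow hF hμ hv ν hθ.neg).mul hu.1.comp_snd
  -- The shear (r, x) ↦ (r, Φ(x, rt)) turns v(Φ(x, -rt)) u(x) into v(x) u(Φ(x, rt)).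
  rw [← hT.map_eq] at hm
  have h1 := integral_map hT.measurable.aemeasurable hm
  rw [hT.map_eq] at h1
  simp only [flow_flow_neg hF] at h1
  rw [h1, integral_prod_symm _ hi, ← integral_const_mul]
  refine integral_congr_ae (ae_of_all _ fun x => ?_)
  simp only [integral_const_mul, integral_zero_eq_mul (fun s => u (flow F x s)) t]
  ring

theorem integral_mul_integral_flow_comm (hF : LipschitzWith κ F)
    (hμ : ∀ t, MeasurePreserving (fun x => flow F x t) μ μ)
    {u v : EuclideanSpace ℝ (Fin N) → ℝ} (hu : Integrable u μ) (hv : AEStronglyMeasurable v μ)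
    {C : ℝ} (hC : ∀ x, |v x| ≤ C) (t : ℝ) :
    ∫ x, v x * (∫ s in (0 : ℝ)..t, u (flow F x s)) ∂μ =
      ∫ x, u x * (∫ s in (0 : ℝ)..t, v (flow F x (-s))) ∂μ := by
  rw [integral_mul_integral_flow hF hμ hu hv hC]
  set ν : Measure ℝ := volume.restrict (Ioc (0 : ℝ) 1)
  have hi : Integrable (fun p : ℝ × EuclideanSpace ℝ (Fin N) =>
      v (flow F p.2 (-(p.1 * t))) * u p.2) (ν.prod μ) :=
    (hu.comp_snd ν).bdd_mul
      (aestronglyMeasurable_comp_flow hF hμ hv ν (θ := fun r => -(r * t)) (by fun_prop))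
      (ae_of_all _ fun p => hC _)
  rw [integral_prod_symm _ hi, ← integral_const_mul]
  refine integral_congr_ae (ae_of_all _ fun x => ?_)
  simp only [integral_mul_const, integral_zero_eq_mul (fun s => v (flow F x (-s))) t]
  ring

theorem integrable_integral_flow (hF : LipschitzWith κ F)
    (hμ : ∀ t, MeasurePreserving (fun x => flow F x t) μ μ)
    {u : EuclideanSpace ℝ (Fin N) → ℝ} (hu : Integrable u μ) (t : ℝ) :
    Integrable (fun x => ∫ s in (0 : ℝ)..t, u (flow F x s)) μ := by
  simp only [fun x => integral_zero_eq_mul (fun s => u (flow F x s)) t]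
  exact (integrable_comp_flow hF hμ hu (volume.restrict (Ioc (0 : ℝ) 1)) (θ := fun r => r * t)
    (by fun_prop)).integral_prod_right.const_mul t

end Average

/-! ### Stability and pointwise consequences of the mild formulation. -/

section MildForm

variable {N : ℕ} {F : EuclideanSpace ℝ (Fin N) → EuclideanSpace ℝ (Fin N)} {κ : ℝ≥0}
  {μ : Measure (EuclideanSpace ℝ (Fin N))} {Ω : Set (EuclideanSpace ℝ (Fin N))}

/-- Changing g on a null set changes it along almost every trajectory at a null set of times only,
which no time integral sees. This allows f and g to be replaced by measurable functions vanishing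
outside Ω. -/
theorem HasMildForm.congr [SFinite μ] (hF : LipschitzWith κ F)
    (hμ : ∀ t, MeasurePreserving (fun x => flow F x t) μ μ) (hΩ : IsOpen Ω)
    {f₁ f₂ g₁ g₂ : EuclideanSpace ℝ (Fin N) → ℝ} (h : HasMildForm F Ω μ f₁ g₁)
    (hf : f₁ =ᵐ[μ.restrict Ω] f₂) (hg : g₁ =ᵐ[μ.restrict Ω] g₂) : HasMildForm F Ω μ f₂ g₂ := by
  obtain ⟨f', hf', H⟩ := h
  refine ⟨f', hf'.trans hf, ?_⟩
  have h1 := ae_ae_flow hF hμ ((ae_restrict_iff' hΩ.measurableSet).1 hg)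
  filter_upwards [H, ae_restrict_of_ae h1, ae_restrict_mem hΩ.measurableSet]
    with x hx hgx hxΩ t₁ t₂ h₁ h₁₂ h₂
  obtain ⟨hi, he⟩ := hx t₁ t₂ h₁ h₁₂ h₂
  have hm : ∀ s ∈ uIoc t₁ t₂, flow F x s ∈ Ω := by
    intro s hs
    rw [uIoc_of_le h₁₂] at hs
    exact flow_mem_of_mem_stayInterval hF hΩ hxΩ ⟨h₁.trans (EReal.coe_lt_coe_iff.2 hs.1),
      (EReal.coe_le_coe_iff.2 hs.2).trans_lt h₂⟩
  have hc : ∀ᵐ s, s ∈ uIoc t₁ t₂ → g₁ (flow F x s) = g₂ (flow F x s) := by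
    filter_upwards [hgx] with s hs hst using hs (hm s hst)
  refine ⟨hi.congr_ae ((ae_restrict_iff' measurableSet_uIoc).2 hc), ?_⟩
  rw [he, intervalIntegral.integral_congr_ae hc]

/-- The mild formulation on the part of the trajectory between a point and its position at the
time `t`. -/
theorem ae_sub_eq_integral_of_mild (hF : LipschitzWith κ F) (hΩ : IsOpen Ω)
    {f' g : EuclideanSpace ℝ (Fin N) → ℝ}
    (h : ∀ᵐ x ∂μ.restrict Ω, ∀ t₁ t₂ : ℝ, -tauMinus F Ω x < (t₁ : EReal) → t₁ ≤ t₂ →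
      (t₂ : EReal) < tauPlus F Ω x →
        IntervalIntegrable (fun s : ℝ => g (flow F x s)) volume t₁ t₂ ∧
          f' (flow F x t₁) - f' (flow F x t₂) = ∫ s in t₁..t₂, g (flow F x s)) :
    ∀ᵐ x ∂μ, ∀ t, x ∈ stayDomain F Ω t →
      f' x - f' (flow F x t) = ∫ s in (0 : ℝ)..t, g (flow F x s) := by
  filter_upwards [(ae_restrict_iff' hΩ.measurableSet).1 h] with x hx t ht
  have hxΩ := stayDomain_subset hF Ω t ht
  have h0 := zero_mem_stayInterval hF hΩ hxΩ
  have ht' := (mem_stayInterval_iff hF hΩ hxΩ).2 ht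
  rcases le_total 0 t with h | h
  · simpa [flow_zero hF] using (hx hxΩ 0 t h0.1 h ht'.2).2
  · have := (hx hxΩ t 0 ht'.1 h h0.2).2
    rw [flow_zero hF] at this
    rw [intervalIntegral.integral_symm, ← this]
    ring

end MildForm

/-! ### From the weak to the mild formulation. -/

section WeakToMild

variable {N : ℕ} {F : EuclideanSpace ℝ (Fin N) → EuclideanSpace ℝ (Fin N)} {κ : ℝ≥0}
  {μ : Measure (EuclideanSpace ℝ (Fin N))} {Ω : Set (EuclideanSpace ℝ (Fin N))}
  {𝓜 : Set (Set (EuclideanSpace ℝ (Fin N)))}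

/-- A function vanishing in `Ω` outside a compact subset of `Ω` has compact support in `Ω`. -/
theorem isCompact_supp {K : Set (EuclideanSpace ℝ (Fin N))} (hΩ : IsOpen Ω) (hK : IsCompact K)
    (hKΩ : K ⊆ Ω) {ψ : EuclideanSpace ℝ (Fin N) → ℝ} (hψ : ∀ x, x ∉ K → ψ x = 0) :
    IsCompact (supp Ω μ ψ) := by
  have ho : IsOpen (Ω \ K) := hΩ.sdiff hK.isClosed
  have hsub : Ω \ K ⊆ ⋃₀ {U : Set (EuclideanSpace ℝ (Fin N)) |
      IsOpen U ∧ U ⊆ Ω ∧ ∀ᵐ x ∂μ.restrict U, ψ x = 0} :=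
    subset_sUnion_of_mem ⟨ho, sdiff_subset,
      ae_restrict_of_forall_mem ho.measurableSet fun x hx => hψ x hx.2⟩
  have heq : supp Ω μ ψ = K \ ⋃₀ {U : Set (EuclideanSpace ℝ (Fin N)) |
      IsOpen U ∧ U ⊆ Ω ∧ ∀ᵐ x ∂μ.restrict U, ψ x = 0} := by
    ext x
    exact ⟨fun h => ⟨by_contra fun hx => h.2 (hsub ⟨h.1, hx⟩), h.2⟩, fun h => ⟨hKΩ h.1, h.2⟩⟩
  rw [heq]
  exact hK.diff (isOpen_sUnion fun U hU => hU.1)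

/-- The average of `ψ` backwards along trajectories over a time `t`. -/
noncomputable def backwardIntegral
    (F : EuclideanSpace ℝ (Fin N) → EuclideanSpace ℝ (Fin N))
    (ψ : EuclideanSpace ℝ (Fin N) → ℝ) (t : ℝ) (x : EuclideanSpace ℝ (Fin N)) : ℝ :=
  ∫ s in (0 : ℝ)..t, ψ (flow F x (-s))

theorem continuous_backwardIntegral (hF : LipschitzWith κ F)
    {ψ : EuclideanSpace ℝ (Fin N) → ℝ} (hψ : Continuous ψ) (t : ℝ) :
    Continuous (backwardIntegral F ψ t) :=
  intervalIntegral.continuous_parametric_intervalIntegral_of_continuous'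
    (f := fun x s => ψ (flow F x (-s)))
    (hψ.comp (continuous_flow_comp hF continuous_fst continuous_snd.neg)) 0 t

/-- Along a trajectory the backward integral is the integral of ψ over the moving window from r - t
to r, so its derivative is the difference of the end values. -/
theorem hasDerivAt_backwardIntegral (hF : LipschitzWith κ F)
    {ψ : EuclideanSpace ℝ (Fin N) → ℝ} (hψ : Continuous ψ) (t : ℝ)
    (x : EuclideanSpace ℝ (Fin N)) (r : ℝ) :
    HasDerivAt (fun r => backwardIntegral F ψ t (flow F x r))
      (ψ (flow F x r) - ψ (flow F x (r - t))) r := by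
  have hc : Continuous fun s => ψ (flow F x s) := hψ.comp (continuous_flow_right hF x)
  have heq : (fun r => backwardIntegral F ψ t (flow F x r)) = fun r =>
      (∫ s in (0 : ℝ)..r, ψ (flow F x s)) - ∫ s in (0 : ℝ)..(r - t), ψ (flow F x s) := by
    funext r
    simp only [backwardIntegral, flow_flow hF, ← sub_eq_add_neg]
    rw [intervalIntegral.integral_comp_sub_left (fun s => ψ (flow F x s)) r, sub_zero,
      intervalIntegral.integral_interval_sub_left (hc.intervalIntegrable _ _)
        (hc.intervalIntegrable _ _)]
  rw [heq]
  have hd : ∀ b, HasDerivAt (fun r => ∫ s in (0 : ℝ)..r, ψ (flow F x s)) (ψ (flow F x b)) b :=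
    fun b => intervalIntegral.integral_hasDerivAt_right (hc.intervalIntegrable _ _)
      (hc.stronglyMeasurableAtFilter _ _) hc.continuousAt
  exact (hd r).sub ((hd (r - t)).comp_sub_const r t)

theorem alongDeriv_backwardIntegral (hF : LipschitzWith κ F)
    {ψ : EuclideanSpace ℝ (Fin N) → ℝ} (hψ : Continuous ψ) (t : ℝ) :
    alongDeriv F (backwardIntegral F ψ t) = fun x => ψ x - ψ (flow F x (-t)) := by
  funext x
  rw [alongDeriv, (hasDerivAt_backwardIntegral hF hψ t x 0).deriv, flow_zero hF, zero_sub]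

/-- The set swept by K under the flow; for K the support of ψ, the backward integral vanishes
outside it. -/
theorem image_flow_subset {K : Set (EuclideanSpace ℝ (Fin N))} {t : ℝ}
    (hK : K ⊆ stayDomain F Ω t) :
    (fun p : ℝ × EuclideanSpace ℝ (Fin N) => flow F p.2 p.1) '' (uIcc 0 t ×ˢ K) ⊆ Ω := by
  rintro _ ⟨p, hp, rfl⟩
  exact mem_stayDomain_iff.1 (hK hp.2) p.1 hp.1

theorem backwardIntegral_eq_zero (hF : LipschitzWith κ F) {ψ : EuclideanSpace ℝ (Fin N) → ℝ}
    {t : ℝ} {x : EuclideanSpace ℝ (Fin N)}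
    (hx : x ∉ (fun p : ℝ × EuclideanSpace ℝ (Fin N) => flow F p.2 p.1) ''
      (uIcc 0 t ×ˢ tsupport ψ)) : backwardIntegral F ψ t x = 0 := by
  refine (intervalIntegral.integral_congr fun s hs => ?_).trans intervalIntegral.integral_zero
  exact image_eq_zero_of_notMem_tsupport fun hm =>
    hx ⟨(s, flow F x (-s)), ⟨hs, hm⟩, flow_neg_flow hF x s⟩

/-- Backward averages of continuous functions with compact support are test functions, as long as
the trajectories starting in the support do not leave `Ω`. -/
theorem isTestFunction_backwardIntegral (hF : LipschitzWith κ F) (hΩ : IsOpen Ω)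
    (h𝓜 : ∀ A : Set (EuclideanSpace ℝ (Fin N)), MeasurableSet A → A ∈ 𝓜)
    {ψ : EuclideanSpace ℝ (Fin N) → ℝ} (hψ : Continuous ψ) (hc : HasCompactSupport ψ) {t : ℝ}
    (hs : tsupport ψ ⊆ stayDomain F Ω t) : IsTestFunction F Ω μ 𝓜 (backwardIntegral F ψ t) := by
  have hmeas : ∀ u : EuclideanSpace ℝ (Fin N) → ℝ, Continuous u →
      ∀ B : Set ℝ, MeasurableSet B → Ω.indicator u ⁻¹' B ∈ 𝓜 := fun u hu B hB =>
    h𝓜 _ ((hu.measurable.indicator hΩ.measurableSet) hB)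
  obtain ⟨C, hC⟩ := hc.exists_bound_of_continuous hψ
  refine ⟨hmeas _ (continuous_backwardIntegral hF hψ t), ⟨C * |t - 0|, fun x _ => ?_⟩,
    isCompact_supp hΩ ((isCompact_uIcc.prod hc).image (continuous_flow hF))
      (image_flow_subset hs) fun x => backwardIntegral_eq_zero hF, fun x _ => ?_, ?_, ?_⟩
  · exact intervalIntegral.norm_integral_le_of_norm_le_const fun s _ => hC _
  · refine ContDiff.contDiffOn (contDiff_one_iff_deriv.2
      ⟨fun r => (hasDerivAt_backwardIntegral hF hψ t x r).differentiableAt, ?_⟩)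
    rw [funext fun r => (hasDerivAt_backwardIntegral hF hψ t x r).deriv]
    exact (hψ.comp (continuous_flow_right hF x)).sub
      (hψ.comp ((continuous_flow_right hF x).comp (continuous_id.sub continuous_const)))
  · rw [alongDeriv_backwardIntegral hF hψ]
    exact hmeas _ (hψ.sub (hψ.comp (continuous_flow_comp hF continuous_id continuous_const)))
  · refine ⟨C + C, fun x _ => ?_⟩
    rw [alongDeriv_backwardIntegral hF hψ]
    exact (norm_sub_le _ _).trans (add_le_add (hC _) (hC _))

theorem IsWeakTransport.congr {f₁ f₂ g₁ g₂ : EuclideanSpace ℝ (Fin N) → ℝ}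
    (h : IsWeakTransport F Ω μ 𝓜 f₁ g₁) (hf : f₁ =ᵐ[μ.restrict Ω] f₂)
    (hg : g₁ =ᵐ[μ.restrict Ω] g₂) : IsWeakTransport F Ω μ 𝓜 f₂ g₂ := by
  refine ⟨h.1.congr hg, fun ψ hψ => ?_⟩
  exact (integral_congr_ae (hg.mul (ae_eq_refl ψ))).symm.trans
    ((h.2 ψ hψ).trans (integral_congr_ae (hf.mul (ae_eq_refl (alongDeriv F ψ)))))

/-- An integrable function on `Ω` agrees almost everywhere on `Ω` with a measurable function that
is integrable on the whole space and vanishes outside `Ω`. -/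
theorem exists_measurable_integrable_ae_eq (hΩ : IsOpen Ω) {f : EuclideanSpace ℝ (Fin N) → ℝ}
    (hf : IntegrableOn f Ω μ) : ∃ f₀ : EuclideanSpace ℝ (Fin N) → ℝ,
      Measurable f₀ ∧ Integrable f₀ μ ∧ (∀ x, x ∉ Ω → f₀ x = 0) ∧ f₀ =ᵐ[μ.restrict Ω] f := by
  refine ⟨Ω.indicator (hf.1.mk f), hf.1.measurable_mk.indicator hΩ.measurableSet,
    IntegrableOn.integrable_indicator (hf.congr hf.1.ae_eq_mk) hΩ.measurableSet,
    fun x hx => indicator_of_notMem hx _, ?_⟩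
  filter_upwards [hf.1.ae_eq_mk, ae_restrict_mem hΩ.measurableSet] with x hx hxΩ
  rw [indicator_of_mem hxΩ, ← hx]

variable [IsFiniteMeasureOnCompacts μ]

/-- The mild formulation at a fixed time. -/
theorem IsWeakTransport.ae_sub_eq_integral (hF : LipschitzWith κ F)
    (hμ : ∀ t, MeasurePreserving (fun x => flow F x t) μ μ) (hΩ : IsOpen Ω)
    (h𝓜 : ∀ A : Set (EuclideanSpace ℝ (Fin N)), MeasurableSet A → A ∈ 𝓜)
    {f g : EuclideanSpace ℝ (Fin N) → ℝ} (hf : Integrable f μ) (hg : Integrable g μ)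
    (h : IsWeakTransport F Ω μ 𝓜 f g) (t : ℝ) :
    ∀ᵐ x ∂μ, x ∈ stayDomain F Ω t →
      f x - f (flow F x t) = ∫ s in (0 : ℝ)..t, g (flow F x s) := by
  have hft : Integrable (fun x => f (flow F x t)) μ := ((hμ t).integrable_comp hf.1).2 hf
  have hgt := integrable_integral_flow hF hμ hg t
  -- Fundamental lemma of the calculus of variations on the open set `stayDomain F Ω t`.
  have key := (isOpen_stayDomain hF hΩ t).ae_eq_zero_of_integral_contDiff_smul_eq_zero (μ := μ)
    (f := fun x => f x - f (flow F x t) - ∫ s in (0 : ℝ)..t, g (flow F x s))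
    (((hf.sub hft).sub hgt).locallyIntegrable.locallyIntegrableOn _) (by
      intro ψ hψ hc hs
      have hψc := hψ.continuous
      obtain ⟨C, hC⟩ := hc.exists_bound_of_continuous hψc
      have hb : ∀ u : EuclideanSpace ℝ (Fin N) → ℝ, Integrable u μ →
          Integrable (fun x => ψ x * u x) μ := fun u hu =>
        hu.bdd_mul hψc.aestronglyMeasurable (ae_of_all _ hC)
      have hw := h.2 _ (isTestFunction_backwardIntegral hF hΩ h𝓜 hψc hc hs)
      have hK := image_flow_subset hs
      -- Both integrands vanish outside Ω; the integrals pass to the whole space, where the flow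
      -- preserves μ.
      rw [alongDeriv_backwardIntegral hF hψc,
        setIntegral_eq_integral_of_forall_compl_eq_zero fun x hx => by
          rw [backwardIntegral_eq_zero hF fun hm => hx (hK hm), mul_zero],
        setIntegral_eq_integral_of_forall_compl_eq_zero fun x hx => by
          beta_reduce
          rw [image_eq_zero_of_notMem_tsupport fun hm => hx (stayDomain_subset hF Ω t (hs hm)),
            image_eq_zero_of_notMem_tsupport (x := flow F x (-t)) fun hm =>
              hx (hK ⟨(t, flow F x (-t)), ⟨right_mem_uIcc, hm⟩, flow_neg_flow hF x t⟩),
            sub_zero, mul_zero]] at hw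
      have h1 : ∫ x, ψ x * (∫ s in (0 : ℝ)..t, g (flow F x s)) ∂μ =
          ∫ x, g x * backwardIntegral F ψ t x ∂μ :=
        integral_mul_integral_flow_comm hF hμ hg hψc.aestronglyMeasurable hC t
      have hψt : Continuous fun x => ψ (flow F x (-t)) :=
        hψc.comp (continuous_flow_comp hF continuous_id continuous_const)
      have h2 : ∫ x, f x * ψ (flow F x (-t)) ∂μ = ∫ x, ψ x * f (flow F x t) ∂μ := by
        simpa only [mul_comm] using
          integral_mul_comp_flow_neg hF hμ hf.1 hψc.aestronglyMeasurable t
      have h3 : ∫ x, f x * (ψ x - ψ (flow F x (-t))) ∂μ =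
          ∫ x, ψ x * f x ∂μ - ∫ x, ψ x * f (flow F x t) ∂μ := by
        rw [← h2, ← integral_sub (hb f hf)
          (hf.mul_bdd hψt.aestronglyMeasurable (ae_of_all _ fun x => hC _))]
        refine integral_congr_ae (ae_of_all _ fun x => ?_)
        simp only
        ring
      simp only [smul_eq_mul, mul_sub]
      have h4 : Integrable (fun x => ψ x * f x - ψ x * f (flow F x t)) μ :=
        (hb _ hf).sub (hb _ hft)
      rw [integral_sub h4 (hb _ hgt), integral_sub (hb _ hf) (hb _ hft), h1, hw, h3, sub_self])
  filter_upwards [key] with x hx hxt using sub_eq_zero.1 (hx hxt)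

/-- `f + ∫₀ᵗ g` has the constant value `c` at almost every point of the trajectory of `x`
in `Ω`. -/
def AEConstAlong (F : EuclideanSpace ℝ (Fin N) → EuclideanSpace ℝ (Fin N))
    (Ω : Set (EuclideanSpace ℝ (Fin N))) (f g : EuclideanSpace ℝ (Fin N) → ℝ)
    (x : EuclideanSpace ℝ (Fin N)) (c : ℝ) : Prop :=
  ∀ᵐ t : ℝ, t ∈ stayInterval F Ω x → f (flow F x t) + ∫ s in (0 : ℝ)..t, g (flow F x s) = c

theorem AEConstAlong.unique (hF : LipschitzWith κ F) (hΩ : IsOpen Ω)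
    {f g : EuclideanSpace ℝ (Fin N) → ℝ} {x : EuclideanSpace ℝ (Fin N)} (hx : x ∈ Ω) {c d : ℝ}
    (hc : AEConstAlong F Ω f g x c) (hd : AEConstAlong F Ω f g x d) : c = d := by
  have ho := (isOpen_stayInterval hF hΩ hx).mem_nhds (zero_mem_stayInterval hF hΩ hx)
  -- Positive length provides a time at which both almost sure values are attained.
  have hpos : volume (stayInterval F Ω x) ≠ 0 := (Measure.measure_pos_of_mem_nhds volume ho).ne'
  have hf : ∃ᶠ t in ae (volume : Measure ℝ), t ∈ stayInterval F Ω x :=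
    frequently_ae_iff.2 hpos
  obtain ⟨t, ht, h1, h2⟩ := (hf.and_eventually (hc.and hd)).exists
  rw [← h1 ht, ← h2 ht]

/-- A null set of times remains null after translation by t, so this holds for every t in the stay
interval without exception. -/
theorem AEConstAlong.flow (hF : LipschitzWith κ F) (hΩ : IsOpen Ω)
    {f g : EuclideanSpace ℝ (Fin N) → ℝ} {x : EuclideanSpace ℝ (Fin N)} (hx : x ∈ Ω) {c : ℝ}
    (hg : ∀ a b : ℝ, IntervalIntegrable (fun s => g (flow F x s)) volume a b)
    (hc : AEConstAlong F Ω f g x c) {t : ℝ} (ht : t ∈ stayInterval F Ω x) :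
    AEConstAlong F Ω f g (Transport.flow F x t)
      (c - ∫ s in (0 : ℝ)..t, g (Transport.flow F x s)) := by
  filter_upwards [(measurePreserving_add_left volume t).quasiMeasurePreserving.ae hc] with r hr hm
  rw [← hr ((mem_stayInterval_flow_iff hF hΩ hx ht).1 hm)]
  simp only [flow_flow hF]
  rw [intervalIntegral.integral_comp_add_left (fun s => g (Transport.flow F x s)) t, add_zero,
    ← intervalIntegral.integral_interval_sub_left (hg 0 (t + r)) (hg 0 t)]
  ring

/-- Fubini exchanges "for every t, almost every x" for "for almost every x, almost every t". Borel
measurability of f and g is what makes the set of good pairs (t, x) measurable. -/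
theorem ae_aeConstAlong (hF : LipschitzWith κ F) (hΩ : IsOpen Ω)
    {f g : EuclideanSpace ℝ (Fin N) → ℝ} (hf : Measurable f) (hg : Measurable g)
    (h : ∀ t, ∀ᵐ x ∂μ, x ∈ stayDomain F Ω t →
      f x - f (flow F x t) = ∫ s in (0 : ℝ)..t, g (flow F x s)) :
    ∀ᵐ x ∂μ, x ∈ Ω → AEConstAlong F Ω f g x (f x) := by
  have hΦ := (continuous_flow hF).measurable
  have hG : Measurable fun p : ℝ × EuclideanSpace ℝ (Fin N) =>
      ∫ s in (0 : ℝ)..p.1, g (flow F p.2 s) := by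
    simp only [fun p : ℝ × EuclideanSpace ℝ (Fin N) =>
      integral_zero_eq_mul (fun s => g (flow F p.2 s)) p.1]
    have hm : Measurable fun q : (ℝ × EuclideanSpace ℝ (Fin N)) × ℝ =>
        g (flow F q.1.2 (q.2 * q.1.1)) :=
      hg.comp (continuous_flow_comp hF (by fun_prop) (by fun_prop)).measurable
    exact measurable_fst.mul hm.stronglyMeasurable.integral_prod_right.measurable
  have hS : MeasurableSet {p : ℝ × EuclideanSpace ℝ (Fin N) | p.2 ∈ stayDomain F Ω p.1 →
      f p.2 - f (flow F p.2 p.1) = ∫ s in (0 : ℝ)..p.1, g (flow F p.2 s)} :=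
    (isOpen_setOf_mem_stayDomain hF hΩ).measurableSet.imp
      (measurableSet_eq_fun ((hf.comp measurable_snd).sub (hf.comp hΦ)) hG)
  filter_upwards [(Measure.ae_ae_comm hS).1 (ae_of_all volume h)] with x hx hxΩ
  filter_upwards [hx] with t ht hm
  rw [← ht ((mem_stayInterval_iff hF hΩ hxΩ).1 hm)]
  ring

/-- The representative of f at a point is the almost sure constant of its trajectory, an arbitrary
value if there is none. At a good x the constant is f(x), and it is then known at every point of the
trajectory of x in Ω. -/
theorem hasMildForm_of_isWeakTransport_of_measurable (hF : LipschitzWith κ F)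
    (hμ : ∀ t, MeasurePreserving (fun x => flow F x t) μ μ) (hΩ : IsOpen Ω)
    (h𝓜 : ∀ A : Set (EuclideanSpace ℝ (Fin N)), MeasurableSet A → A ∈ 𝓜)
    {f g : EuclideanSpace ℝ (Fin N) → ℝ} (hfm : Measurable f) (hgm : Measurable g)
    (hf : Integrable f μ) (hg : Integrable g μ)
    (h : IsWeakTransport F Ω μ 𝓜 f g) : HasMildForm F Ω μ f g := by
  have hc := ae_aeConstAlong (μ := μ) hF hΩ hfm hgm (h.ae_sub_eq_integral hF hμ hΩ h𝓜 hf hg)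
  have heq : ∀ {x c}, x ∈ Ω → AEConstAlong F Ω f g x c →
      Classical.epsilon (AEConstAlong F Ω f g x) = c := fun hx h =>
    AEConstAlong.unique hF hΩ hx (Classical.epsilon_spec ⟨_, h⟩) h
  refine ⟨fun x => Classical.epsilon (AEConstAlong F Ω f g x), ?_, ?_⟩
  · filter_upwards [ae_restrict_of_ae hc, ae_restrict_mem hΩ.measurableSet] with x hx hxΩ
      using heq hxΩ (hx hxΩ)
  · filter_upwards [ae_restrict_of_ae hc, ae_restrict_mem hΩ.measurableSet,
      ae_restrict_of_ae (ae_intervalIntegrable_flow hF hμ hg)] with x hx hxΩ hi t₁ t₂ h₁ h₁₂ h₂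
    have hval : ∀ {t}, t ∈ stayInterval F Ω x →
        Classical.epsilon (AEConstAlong F Ω f g (flow F x t)) =
          f x - ∫ s in (0 : ℝ)..t, g (flow F x s) := fun ht =>
      heq (flow_mem_of_mem_stayInterval hF hΩ hxΩ ht) ((hx hxΩ).flow hF hΩ hxΩ hi ht)
    have h12 : (t₁ : EReal) ≤ t₂ := EReal.coe_le_coe_iff.2 h₁₂
    refine ⟨hi t₁ t₂, ?_⟩
    simp only [hval ⟨h₁, h12.trans_lt h₂⟩, hval ⟨h₁.trans_le h12, h₂⟩]
    rw [← intervalIntegral.integral_interval_sub_left (hi 0 t₂) (hi 0 t₁)]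
    ring

/-- The weak formulation implies the mild one. -/
theorem hasMildForm_of_isWeakTransport (hF : LipschitzWith κ F)
    (hμ : ∀ t, MeasurePreserving (fun x => flow F x t) μ μ) (hΩ : IsOpen Ω)
    (h𝓜 : ∀ A : Set (EuclideanSpace ℝ (Fin N)), MeasurableSet A → A ∈ 𝓜)
    {f g : EuclideanSpace ℝ (Fin N) → ℝ} (hf : IntegrableOn f Ω μ)
    (h : IsWeakTransport F Ω μ 𝓜 f g) : HasMildForm F Ω μ f g := by
  obtain ⟨f₀, hfm, hfi, -, hfe⟩ := exists_measurable_integrable_ae_eq hΩ hf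
  obtain ⟨g₀, hgm, hgi, -, hge⟩ := exists_measurable_integrable_ae_eq hΩ h.1
  exact (hasMildForm_of_isWeakTransport_of_measurable hF hμ hΩ h𝓜 hfm hgm hfi hgi
    (h.congr hfe.symm hge.symm)).congr hF hμ hΩ hfe hge

end WeakToMild

/-! ### From the mild to the weak formulation. -/

section MildToWeak

variable {N : ℕ} {F : EuclideanSpace ℝ (Fin N) → EuclideanSpace ℝ (Fin N)} {κ : ℝ≥0}
  {μ : Measure (EuclideanSpace ℝ (Fin N))} {Ω : Set (EuclideanSpace ℝ (Fin N))}
  {𝓜 : Set (Set (EuclideanSpace ℝ (Fin N)))}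

/-- A function vanishes almost everywhere outside its support. -/
theorem ae_eq_zero_of_notMem_supp (Ω : Set (EuclideanSpace ℝ (Fin N)))
    (μ : Measure (EuclideanSpace ℝ (Fin N))) (ψ : EuclideanSpace ℝ (Fin N) → ℝ) :
    ∀ᵐ x ∂μ, x ∈ Ω → x ∉ supp Ω μ ψ → ψ x = 0 := by
  set S : Set (Set (EuclideanSpace ℝ (Fin N))) :=
    {U | IsOpen U ∧ U ⊆ Ω ∧ ∀ᵐ x ∂μ.restrict U, ψ x = 0} with hS
  -- Lindelöf: countably many of the open sets cover the union, so their null sets add up to a null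
  -- set.
  obtain ⟨T, hTc, hTS, hT⟩ := TopologicalSpace.isOpen_sUnion_countable S fun U hU => hU.1
  have hz : ∀ᵐ x ∂μ.restrict (⋃₀ S), ψ x = 0 := by
    rw [← hT, sUnion_eq_biUnion]
    exact (ae_restrict_biUnion_iff _ hTc _).2 fun U hU => (hTS hU).2.2
  have ho : IsOpen (⋃₀ S) := isOpen_sUnion fun U hU => hU.1
  filter_upwards [(ae_restrict_iff' ho.measurableSet).1 hz] with x hx hxΩ hxs
  exact hx (by_contra fun h => hxs ⟨hxΩ, h⟩)

theorem eventually_subset_stayDomain (hF : LipschitzWith κ F) (hΩ : IsOpen Ω)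
    {K : Set (EuclideanSpace ℝ (Fin N))} (hK : IsCompact K) (hKΩ : K ⊆ Ω) :
    ∀ᶠ t in 𝓝 (0 : ℝ), K ⊆ stayDomain F Ω t := by
  refine hK.eventually_forall_of_forall_eventually fun x hx => ?_
  refine (isOpen_setOf_mem_stayDomain hF hΩ).mem_nhds (x := ((0 : ℝ), x)) ?_
  exact (mem_stayInterval_iff hF hΩ (hKΩ hx)).1 (zero_mem_stayInterval hF hΩ (hKΩ hx))

/-- By the group law, the derivative at time 0 from Φ(x, s) is the derivative at time s from x. -/
theorem IsTestFunction.hasDerivAt (hF : LipschitzWith κ F) (hΩ : IsOpen Ω)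
    {ψ : EuclideanSpace ℝ (Fin N) → ℝ} (hψ : IsTestFunction F Ω μ 𝓜 ψ)
    {x : EuclideanSpace ℝ (Fin N)} (hx : x ∈ Ω) {s : ℝ} (hs : s ∈ stayInterval F Ω x) :
    HasDerivAt (fun s => ψ (flow F x s)) (alongDeriv F ψ (flow F x s)) s := by
  have hd : DifferentiableAt ℝ (fun s => ψ (flow F x s)) s :=
    ((hψ.contDiffOn x hx).differentiableOn one_ne_zero).differentiableAt
      ((isOpen_stayInterval hF hΩ hx).mem_nhds hs)
  have he : alongDeriv F ψ (flow F x s) = deriv (fun s => ψ (flow F x s)) s := by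
    simp only [alongDeriv, flow_flow hF]
    rw [deriv_comp_const_add (fun s => ψ (flow F x s)), add_zero]
  rw [he]
  exact hd.hasDerivAt

/-- Mean value inequality; it dominates the difference quotients of a test function in the limit t →
0. -/
theorem IsTestFunction.abs_sub_le (hF : LipschitzWith κ F) (hΩ : IsOpen Ω)
    {ψ : EuclideanSpace ℝ (Fin N) → ℝ} (hψ : IsTestFunction F Ω μ 𝓜 ψ) {C : ℝ}
    (hC : ∀ x ∈ Ω, |alongDeriv F ψ x| ≤ C) {x : EuclideanSpace ℝ (Fin N)} {t : ℝ}
    (hx : x ∈ stayDomain F Ω t) : |ψ (flow F x t) - ψ x| ≤ C * |t| := by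
  have hxΩ := stayDomain_subset hF Ω t hx
  have hI : uIcc 0 t ⊆ stayInterval F Ω x := (ordConnected_stayInterval F Ω x).uIcc_subset
    (zero_mem_stayInterval hF hΩ hxΩ) ((mem_stayInterval_iff hF hΩ hxΩ).2 hx)
  have h := Convex.norm_image_sub_le_of_norm_hasDerivWithin_le (f := fun s => ψ (flow F x s))
    (fun s hs => (hψ.hasDerivAt hF hΩ hxΩ (hI hs)).hasDerivWithinAt)
    (fun s hs => hC _ (flow_mem_of_mem_stayInterval hF hΩ hxΩ (hI hs))) (convex_uIcc 0 t)
    left_mem_uIcc right_mem_uIcc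
  simpa [flow_zero hF] using h

/-- The extension by zero of a test function is differentiable at time `0` along every trajectory
that starts in `Ω`. -/
theorem IsTestFunction.hasDerivAt_indicator (hF : LipschitzWith κ F) (hΩ : IsOpen Ω)
    {ψ : EuclideanSpace ℝ (Fin N) → ℝ} (hψ : IsTestFunction F Ω μ 𝓜 ψ)
    {x : EuclideanSpace ℝ (Fin N)} (hx : x ∈ Ω) :
    HasDerivAt (fun s => Ω.indicator ψ (flow F x s)) (alongDeriv F ψ x) 0 := by
  have h0 := zero_mem_stayInterval hF hΩ hx
  have hd := hψ.hasDerivAt hF hΩ hx h0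
  rw [flow_zero hF] at hd
  refine hd.congr_of_eventuallyEq ?_
  filter_upwards [(isOpen_stayInterval hF hΩ hx).mem_nhds h0] with s hs
  exact indicator_of_mem (flow_mem_of_mem_stayInterval hF hΩ hx hs) _

variable [IsFiniteMeasureOnCompacts μ]

/-- The mild formulation tested against a function that vanishes outside a set whose trajectories
stay in `Ω`. -/
theorem integral_mul_sub_of_mild (hF : LipschitzWith κ F)
    (hμ : ∀ t, MeasurePreserving (fun x => flow F x t) μ μ) (hΩ : IsOpen Ω)
    {f g : EuclideanSpace ℝ (Fin N) → ℝ} (hf : Integrable f μ) (hg : Integrable g μ)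
    (h : HasMildForm F Ω μ f g) {v : EuclideanSpace ℝ (Fin N) → ℝ}
    (hv : AEStronglyMeasurable v μ) {C : ℝ} (hC : ∀ x, |v x| ≤ C) {t : ℝ}
    (hz : ∀ᵐ x ∂μ, x ∉ stayDomain F Ω (-t) → v x = 0) :
    ∫ x, f x * (v (flow F x t) - v x) ∂μ =
      t * ∫ p, v (flow F p.2 (p.1 * t)) * g p.2 ∂(volume.restrict (Ioc (0 : ℝ) 1)).prod μ := by
  obtain ⟨f', hf', H⟩ := h
  have hf'' : ∀ᵐ x ∂μ, x ∈ Ω → f' x = f x := (ae_restrict_iff' hΩ.measurableSet).1 hf'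
  have hft : Integrable (fun x => f (flow F x (-t))) μ :=
    ((hμ (-t)).integrable_comp hf.1).2 hf
  have hvt : AEStronglyMeasurable (fun x => v (flow F x t)) μ :=
    hv.comp_quasiMeasurePreserving (hμ t).quasiMeasurePreserving
  -- The mild identity is used backwards, over the time -t, so that the duality produces v∘Φ_t.
  have h1 : ∫ x, v x * (∫ s in (0 : ℝ)..(-t), g (flow F x s)) ∂μ =
      ∫ x, (v x * f x - v x * f (flow F x (-t))) ∂μ := by
    refine integral_congr_ae ?_
    filter_upwards [hz, hf'', (hμ (-t)).quasiMeasurePreserving.ae hf'',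
      ae_sub_eq_integral_of_mild hF hΩ H] with x hx h2 h3 h4
    by_cases hs : x ∈ stayDomain F Ω (-t)
    · have hm : flow F x (-t) ∈ Ω := by simpa using hs 1 (by simp)
      rw [← h4 _ hs, h2 (stayDomain_subset hF Ω _ hs), h3 hm]
      ring
    · simp [hx hs]
  have h2 := integral_mul_comp_flow_neg hF hμ hv hf.1 t
  rw [integral_mul_integral_flow hF hμ hg hv hC,
    integral_sub (hf.bdd_mul hv (ae_of_all _ hC)) (hft.bdd_mul hv (ae_of_all _ hC)), h2] at h1
  simp only [mul_neg, neg_neg] at h1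
  have h3 : ∫ x, f x * (v (flow F x t) - v x) ∂μ =
      ∫ x, v (flow F x t) * f x ∂μ - ∫ x, v x * f x ∂μ := by
    rw [← integral_sub (hf.bdd_mul hvt (ae_of_all _ fun x => hC _))
      (hf.bdd_mul hv (ae_of_all _ hC))]
    refine integral_congr_ae (ae_of_all _ fun x => ?_)
    simp only
    ring
  linarith

theorem isWeakTransport_of_hasMildForm_of_integrable (hF : LipschitzWith κ F)
    (hμ : ∀ t, MeasurePreserving (fun x => flow F x t) μ μ) (hΩ : IsOpen Ω)
    (h𝓜 : ∀ A ∈ 𝓜, NullMeasurableSet A μ)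
    {f g : EuclideanSpace ℝ (Fin N) → ℝ} (hf : Integrable f μ) (hg : Integrable g μ)
    (hf0 : ∀ x, x ∉ Ω → f x = 0) (hg0 : ∀ x, x ∉ Ω → g x = 0)
    (h : HasMildForm F Ω μ f g) : IsWeakTransport F Ω μ 𝓜 f g := by
  refine ⟨hg.integrableOn, fun ψ hψ => ?_⟩
  set ν : Measure ℝ := volume.restrict (Ioc (0 : ℝ) 1) with hν
  have : IsProbabilityMeasure ν := ⟨by simp [hν]⟩
  set v := Ω.indicator ψ with hv_def
  have hv : AEStronglyMeasurable v μ :=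
    (NullMeasurable.aemeasurable fun B hB => h𝓜 _ (hψ.measurable B hB)).aestronglyMeasurable
  obtain ⟨C, hC⟩ := hψ.bounded
  obtain ⟨D, hD⟩ := hψ.deriv_bounded
  -- The maximum with 0 is needed because C bounds ψ on Ω only and may be negative if Ω is empty.
  have hvC : ∀ x, |v x| ≤ max C 0 := fun x => by
    by_cases hx : x ∈ Ω
    · rw [hv_def, indicator_of_mem hx]
      exact (hC x hx).trans (le_max_left _ _)
    · rw [hv_def, indicator_of_notMem hx, abs_zero]
      exact le_max_right _ _
  have hvt : ∀ t, AEStronglyMeasurable (fun x => v (flow F x t)) μ := fun t =>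
    hv.comp_quasiMeasurePreserving (hμ t).quasiMeasurePreserving
  have hz : ∀ᵐ x ∂μ, x ∉ supp Ω μ ψ → v x = 0 := by
    filter_upwards [ae_eq_zero_of_notMem_supp Ω μ ψ] with x hx hxs
    by_cases hxΩ : x ∈ Ω
    · rw [hv_def, indicator_of_mem hxΩ, hx hxΩ hxs]
    · exact indicator_of_notMem hxΩ _
  have hK : ∀ᶠ t in 𝓝[≠] (0 : ℝ), supp Ω μ ψ ⊆ stayDomain F Ω (-t) := by
    have h0 : Tendsto (fun t : ℝ => -t) (𝓝[≠] 0) (𝓝 0) :=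
      ((continuous_neg.tendsto' (0 : ℝ) 0 neg_zero)).mono_left nhdsWithin_le_nhds
    exact h0.eventually (eventually_subset_stayDomain hF hΩ hψ.compact_supp sdiff_subset)
  have hK' : ∀ᶠ t in 𝓝[≠] (0 : ℝ), supp Ω μ ψ ⊆ stayDomain F Ω t :=
    nhdsWithin_le_nhds (eventually_subset_stayDomain hF hΩ hψ.compact_supp sdiff_subset)
  have hid : ∀ᶠ t in 𝓝[≠] (0 : ℝ), ∫ x, f x * (t⁻¹ • (v (flow F x t) - v x)) ∂μ =
      ∫ p, v (flow F p.2 (p.1 * t)) * g p.2 ∂ν.prod μ := by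
    filter_upwards [hK, self_mem_nhdsWithin] with t ht ht0
    have hs := integral_mul_sub_of_mild hF hμ hΩ hf hg h hv hvC (t := t)
      (hz.mono fun x hx hxs => hx fun hm => hxs (ht hm))
    have ht0' : t ≠ 0 := ht0
    rw [← hν] at hs
    rw [← inv_mul_cancel_left₀ ht0' (∫ p, v (flow F p.2 (p.1 * t)) * g p.2 ∂ν.prod μ), ← hs,
      ← integral_const_mul]
    refine integral_congr_ae (ae_of_all _ fun x => ?_)
    simp only [smul_eq_mul]
    ring
  -- The difference quotients converge to the derivative along the flow at points of Ω, and f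
  -- vanishes elsewhere.
  have hL : Tendsto (fun t => ∫ x, f x * (t⁻¹ • (v (flow F x t) - v x)) ∂μ) (𝓝[≠] 0)
      (𝓝 (∫ x, f x * alongDeriv F ψ x ∂μ)) := by
    refine tendsto_integral_filter_of_dominated_convergence (fun x => ‖f x‖ * max D 0)
      (Eventually.of_forall fun t => hf.1.mul (((hvt t).sub hv).const_smul t⁻¹)) ?_
      (hf.norm.mul_const _) (ae_of_all _ fun x => ?_)
    · filter_upwards [hK, hK', self_mem_nhdsWithin] with t ht ht' ht0
      filter_upwards [hz, (hμ t).quasiMeasurePreserving.ae hz] with x hx hxt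
      rw [norm_mul]
      refine mul_le_mul_of_nonneg_left ?_ (norm_nonneg _)
      by_cases hm : x ∈ stayDomain F Ω t
      · have hmt : flow F x t ∈ Ω := by simpa using hm 1 (by simp)
        rw [hv_def, indicator_of_mem hmt, indicator_of_mem (stayDomain_subset hF Ω t hm),
          norm_smul, norm_inv, Real.norm_eq_abs, Real.norm_eq_abs]
        refine (inv_mul_le_iff₀ (abs_pos.2 ht0)).2 ?_
        rw [mul_comm]
        exact (hψ.abs_sub_le hF hΩ hD hm).trans
          (mul_le_mul_of_nonneg_right (le_max_left _ _) (abs_nonneg _))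
      -- If the trajectory leaves Ω between the times 0 and t, neither endpoint lies in the support
      -- of ψ. Off a null set the quotient is then 0, although the mean value bound is unavailable.
      · rw [hx fun hs => hm (ht' hs),
          hxt fun hs => hm ((flow_mem_stayDomain_neg hF).1 (ht hs))]
        simp
    · by_cases hx : x ∈ Ω
      · have hd := hasDerivAt_iff_tendsto_slope_zero.1 (hψ.hasDerivAt_indicator hF hΩ hx)
        simp only [zero_add, flow_zero hF] at hd
        exact hd.const_mul (f x)
      · simp [hf0 x hx]
  have hR : Tendsto (fun t => ∫ p, v (flow F p.2 (p.1 * t)) * g p.2 ∂ν.prod μ) (𝓝[≠] 0)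
      (𝓝 (∫ p, v p.2 * g p.2 ∂ν.prod μ)) := by
    refine tendsto_integral_filter_of_dominated_convergence (fun p => max C 0 * ‖g p.2‖)
      (Eventually.of_forall fun t => (aestronglyMeasurable_comp_flow hF hμ hv ν
        (θ := fun r => r * t) (by fun_prop)).mul hg.1.comp_snd)
      (Eventually.of_forall fun t => ae_of_all _ fun p => ?_)
      ((hg.comp_snd ν).norm.const_mul _) (ae_of_all _ fun p => ?_)
    · rw [norm_mul]
      exact mul_le_mul_of_nonneg_right (hvC _) (norm_nonneg _)
    · by_cases hx : p.2 ∈ Ω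
      · have hc := (hψ.hasDerivAt_indicator hF hΩ hx).continuousAt.tendsto
        rw [flow_zero hF] at hc
        have h0 : Tendsto (fun t : ℝ => p.1 * t) (𝓝[≠] 0) (𝓝 0) :=
          ((continuous_const_mul p.1).tendsto' 0 0 (mul_zero _)).mono_left nhdsWithin_le_nhds
        exact (hc.comp h0).mul_const _
      · simp [hg0 _ hx]
  have hlim := tendsto_nhds_unique (hL.congr' hid) hR
  -- The limit no longer depends on r, and r ranges over a probability space.
  rw [integral_fun_snd (fun x => v x * g x)] at hlim
  simp only [probReal_univ, one_smul] at hlim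
  rw [setIntegral_eq_integral_of_forall_compl_eq_zero fun x hx => by rw [hg0 x hx, zero_mul],
    setIntegral_eq_integral_of_forall_compl_eq_zero fun x hx => by rw [hf0 x hx, zero_mul], hlim]
  refine integral_congr_ae (ae_of_all _ fun x => ?_)
  by_cases hx : x ∈ Ω
  · simp only [hv_def, indicator_of_mem hx, mul_comm]
  · simp [hg0 x hx]

/-- The mild formulation implies the weak one. -/
theorem isWeakTransport_of_hasMildForm (hF : LipschitzWith κ F)
    (hμ : ∀ t, MeasurePreserving (fun x => flow F x t) μ μ) (hΩ : IsOpen Ω)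
    (h𝓜 : ∀ A ∈ 𝓜, NullMeasurableSet A μ)
    {f g : EuclideanSpace ℝ (Fin N) → ℝ} (hf : IntegrableOn f Ω μ) (hg : IntegrableOn g Ω μ)
    (h : HasMildForm F Ω μ f g) : IsWeakTransport F Ω μ 𝓜 f g := by
  obtain ⟨f₀, -, hfi, hf0, hfe⟩ := exists_measurable_integrable_ae_eq hΩ hf
  obtain ⟨g₀, -, hgi, hg0, hge⟩ := exists_measurable_integrable_ae_eq hΩ hg
  exact (isWeakTransport_of_hasMildForm_of_integrable hF hμ hΩ h𝓜 hfi hgi hf0 hg0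
    (h.congr hF hμ hΩ hfe.symm hge.symm)).congr hfe hge

end MildToWeak

end Transport

/-! ### The equivalence and the identification of g. -/

theorem mainTheorem1 {N : ℕ}
    (F : EuclideanSpace ℝ (Fin N) → EuclideanSpace ℝ (Fin N)) (κ : ℝ≥0) (hF : LipschitzWith κ F)
    (μ : Measure (EuclideanSpace ℝ (Fin N))) [IsFiniteMeasureOnCompacts μ]
    (hμ : ∀ (t : ℝ) (A : Set (EuclideanSpace ℝ (Fin N))), MeasurableSet A →
      μ ((fun x => Transport.flow F x t) '' A) = μ A)
    (Ω : Set (EuclideanSpace ℝ (Fin N))) (hΩ : IsOpen Ω)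
    (f : EuclideanSpace ℝ (Fin N) → ℝ) (hf : IntegrableOn f Ω μ)
    (𝓜 : Set (Set (EuclideanSpace ℝ (Fin N))))
    (h𝓜 : 𝓜 = {A | MeasurableSet A} ∨ 𝓜 = {A | NullMeasurableSet A μ}) :
    ((∃ g : EuclideanSpace ℝ (Fin N) → ℝ, IntegrableOn g Ω μ ∧ Transport.HasMildForm F Ω μ f g) ↔
        f ∈ Transport.domTmax F Ω μ 𝓜) ∧
      (f ∈ Transport.domTmax F Ω μ 𝓜 →
        ∀ g : EuclideanSpace ℝ (Fin N) → ℝ, IntegrableOn g Ω μ →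
          (Transport.HasMildForm F Ω μ f g ↔
            g =ᵐ[μ.restrict Ω] Transport.Tmax F Ω μ 𝓜 f)) := by
  have hΦ := Transport.measurePreserving_flow hF hμ
  -- The weak formulation is exploited only with continuous test functions, for which Borel sets
  -- suffice; deriving it requires only null-measurability. Both conventions lie between these
  -- bounds.
  have h₁ : ∀ A : Set (EuclideanSpace ℝ (Fin N)), MeasurableSet A → A ∈ 𝓜 := by
    rcases h𝓜 with rfl | rfl
    · exact fun A hA => hA
    · exact fun A hA => hA.nullMeasurableSet
  have h₂ : ∀ A ∈ 𝓜, NullMeasurableSet A μ := by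
    rcases h𝓜 with rfl | rfl
    · exact fun A hA => MeasurableSet.nullMeasurableSet hA
    · exact fun A hA => hA
  refine ⟨⟨?_, ?_⟩, fun hdom g hg => ⟨fun h => ?_, fun h => ?_⟩⟩
  · rintro ⟨g, hg, h⟩
    exact ⟨hf, g, Transport.isWeakTransport_of_hasMildForm hF hΦ hΩ h₂ hf hg h⟩
  · rintro ⟨-, g, h⟩
    exact ⟨g, h.1, Transport.hasMildForm_of_isWeakTransport hF hΦ hΩ h₁ hf h⟩
  · exact Transport.isWeakTransport_unique hF hΩ h₁
      (Transport.isWeakTransport_of_hasMildForm hF hΦ hΩ h₂ hf hg h)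
      (Transport.isWeakTransport_Tmax hdom)
  · exact Transport.hasMildForm_of_isWeakTransport hF hΦ hΩ h₁ hf
      ((Transport.isWeakTransport_Tmax hdom).congr (ae_eq_refl f) h.symm)
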